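/- For $f\colon\{0,1\}^n\to\{0,1\}$ and a probability distribution $\mu$ on $\{0,1\}^n\cong\mathbb{Z}_2^n$ let $\mathrm{disc}(f,\mu)=-\log_2\max_S\bigl|\sum_{x\in S}(-1)^{f(x)}\mu(x)\bigr|$, where $S$ ranges over all affine subspaces of $\mathbb{Z}_2^n$, and let $\mathrm{disc}(f)=\max_\mu\mathrm{disc}(f,\mu)$ over all distributions $\mu$. A deterministic parity decision tree queries parities $\langle a,x\rangle=\sum_i a_ix_i \bmod 2$ with $a\in\{0,1\}^n$; let $\mathrm{D}_\epsilon(f,\mu)$ be the least depth of such a tree $T$ with $\Pr_{x\sim\mu}[T(x)\ne f(x)]\le\epsilon$, and let $\mathrm{D}^\times(f)=\max_\mu \mathrm{D}_{1/3}(f,\mu)$ over all product distributions $\mu$ (products of $n$ independent Bernoulli distributions). **Lemma.** The measures $\mathrm{disc}$ and $\mathrm{D}^\times$ are incomparable. As $n\to\infty$: 1. The majority function $\mathrm{MAJ}_n$ (equal to $1$ exactly when more than $n/2$ of the input bits are $1$) satisfies $\mathrm{disc}(\mathrm{MAJ}_n)=O(\log n)$ and $\mathrm{D}^\times(\mathrm{MAJ}_n)=\Theta(n)$.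 2. There are functions $f_n\colon\{0,1\}^n\to\{0,1\}$ with $\mathrm{disc}(f_n)=\Theta(n)$ and $\mathrm{D}^\times(f_n)=O(1)$. Indeed, let $\boldsymbol f\colon\{0,1\}^n\to\{0,1\}$ be the random function whose values $\boldsymbol f(x)$, $x\in\{0,1\}^n$, are independent and equal to $1$ with probability $2^{-0.9n}$. Then there are constants $c,\delta>0$, $C$ and $K$ such that, for all sufficiently large $n$, with probability at least $1-2^{-\delta n}$ we have $cn\le\mathrm{disc}(\boldsymbol f)\le Cn$ and $\mathrm{D}^\times(\boldsymbol f)\le K$. -/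

import Mathlib

open Filter Asymptotics

noncomputable section

namespace ParityTrees

/-- The cube `{0,1}ⁿ`, viewed as the vector space `ℤ₂ⁿ`. -/
abbrev Cube (n : ℕ) : Type := Fin n → ZMod 2

/-- Boolean functions on `n` bits. -/
abbrev BoolFn (n : ℕ) : Type := Cube n → Bool

/-- Probability distributions on the cube, as nonnegative weights that sum to one. -/
abbrev Dist (n : ℕ) : Type := stdSimplex ℝ (Cube n)

/-! ### Discrepancy -/

open Classical in
/-- The bias `|∑_{x ∈ S} (-1)^{f(x)} μ(x)|` of an affine subspace `S`. -/
def bias {n : ℕ} (f : BoolFn n) (μ : Dist n) (S : AffineSubspace (ZMod 2) (Cube n)) : ℝ :=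
  |∑ x : Cube n, if x ∈ S then (if f x then (-1 : ℝ) else 1) * μ.1 x else 0|

/-- `disc(f, μ) = - log₂ max_S bias(f, μ, S)`, over all affine subspaces `S` (finitely many, and
the maximum is positive because points are affine subspaces). -/
def discOn {n : ℕ} (f : BoolFn n) (μ : Dist n) : ℝ :=
  -Real.logb 2 (⨆ S : AffineSubspace (ZMod 2) (Cube n), bias f μ S)

/-- `disc(f) = max_μ disc(f, μ)`, over all distributions `μ` on the cube. -/
def disc {n : ℕ} (f : BoolFn n) : ℝ :=
  ⨆ μ : Dist n, discOn f μ

/-! ### Parity decision trees and distributional complexity -/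

/-- Deterministic parity decision trees: a leaf carries the output, an inner node queries
`⟨a, x⟩ = ∑ᵢ aᵢ xᵢ mod 2` and continues in `t₀` if the answer is `0`, in `t₁` if it is `1`. -/
inductive ParityTree (n : ℕ) : Type
  | leaf (b : Bool) : ParityTree n
  | query (a : Cube n) (t₀ t₁ : ParityTree n) : ParityTree n

namespace ParityTree

/-- The output of a parity tree on the input `x`. -/
def eval {n : ℕ} : ParityTree n → Cube n → Bool
  | leaf b, _ => b
  | query a t₀ t₁, x => if a ⬝ᵥ x = 0 then t₀.eval x else t₁.eval x

/-- The depth of a parity tree: the largest number of queries on a root-to-leaf path. -/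
def depth {n : ℕ} : ParityTree n → ℕ
  | leaf _ => 0
  | query _ t₀ t₁ => max t₀.depth t₁.depth + 1

/-- The error `Pr_{x ∼ μ}[T(x) ≠ f(x)]`. -/
def err {n : ℕ} (T : ParityTree n) (f : BoolFn n) (μ : Dist n) : ℝ :=
  ∑ x : Cube n, if T.eval x ≠ f x then μ.1 x else 0

end ParityTree

/-- `D_ε(f, μ)`: the least depth of a parity tree with error at most `ε` under `μ`. -/
def distComplexity {n : ℕ} (ε : ℝ) (f : BoolFn n) (μ : Dist n) : ℕ :=
  sInf {d : ℕ | ∃ T : ParityTree n, T.depth = d ∧ T.err f μ ≤ ε}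

/-- The product of independent Bernoulli distributions `Ber(p₁) × ⋯ × Ber(pₙ)`. -/
def productDist {n : ℕ} (p : Fin n → unitInterval) : Dist n :=
  ⟨fun x => ∏ i, if x i = 1 then (p i : ℝ) else 1 - (p i : ℝ), by
    constructor
    · intro x
      refine Finset.prod_nonneg fun i _ => ?_
      have h0 := (p i).2.1
      have h1 := (p i).2.2
      split_ifs <;> linarith
    · have h := Finset.prod_univ_sum (fun _ : Fin n => (Finset.univ : Finset (ZMod 2)))
        (fun i b => if b = 1 then (p i : ℝ) else 1 - (p i : ℝ))
      rw [Fintype.piFinset_univ] at h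
      rw [← h]
      refine Finset.prod_eq_one fun i _ => ?_
      have h2 : (Finset.univ : Finset (ZMod 2)) = {0, 1} := by decide
      rw [h2, Finset.sum_pair (by decide)]
      simp⟩

/-- `D^×_ε(f)`: the maximum of `D_ε(f, μ)` over product distributions `μ`. -/
def prodComplexityErr {n : ℕ} (ε : ℝ) (f : BoolFn n) : ℕ :=
  ⨆ p : Fin n → unitInterval, distComplexity ε f (productDist p)

/-- `D^×(f) = D^×_{1/3}(f)`. -/
def prodComplexity {n : ℕ} (f : BoolFn n) : ℕ :=
  prodComplexityErr (1 / 3) f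

/-! ### The suprema above are over bounded families -/

theorem exists_tree_of_dependsOn {n : ℕ} (s : Finset (Fin n)) :
    ∀ f : BoolFn n, (∀ x y : Cube n, (∀ i ∈ s, x i = y i) → f x = f y) →
      ∃ T : ParityTree n, T.depth ≤ s.card ∧ T.eval = f := by
  induction s using Finset.induction_on with
  | empty =>
    intro f hf
    exact ⟨.leaf (f 0), le_rfl, funext fun x => hf 0 x (by simp)⟩
  | insert i s hi ih =>
    intro f hf
    have key : ∀ b : ZMod 2, ∃ T : ParityTree n, T.depth ≤ s.card ∧
        T.eval = fun x => f (Function.update x i b) := by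
      intro b
      refine ih _ fun x y hxy => hf _ _ fun j hj => ?_
      by_cases hji : j = i
      · subst hji
        simp
      · rw [Function.update_of_ne hji, Function.update_of_ne hji]
        exact hxy j ((Finset.mem_insert.1 hj).resolve_left hji)
    obtain ⟨T₀, d₀, e₀⟩ := key 0
    obtain ⟨T₁, d₁, e₁⟩ := key 1
    refine ⟨.query (Pi.single i 1) T₀ T₁, ?_, ?_⟩
    · rw [Finset.card_insert_of_notMem hi]
      simp only [ParityTree.depth]
      omega
    · funext x
      simp only [ParityTree.eval, single_one_dotProduct, e₀, e₁]
      have hx : ∀ z : ZMod 2, z = 0 ∨ z = 1 := by decide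
      rcases hx (x i) with h | h
      · rw [if_pos h, ← h, Function.update_eq_self]
      · rw [if_neg (by rw [h]; decide), ← h, Function.update_eq_self]

theorem distComplexity_le {n : ℕ} {ε : ℝ} (hε : 0 ≤ ε) (f : BoolFn n) (μ : Dist n) :
    distComplexity ε f μ ≤ n := by
  obtain ⟨T, hd, he⟩ := exists_tree_of_dependsOn (Finset.univ : Finset (Fin n)) f
    (fun x y h => congrArg f (funext fun i => h i (Finset.mem_univ i)))
  rw [Finset.card_fin] at hd
  refine le_trans (Nat.sInf_le ⟨T, rfl, ?_⟩) hd
  simp [ParityTree.err, he, hε]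

theorem bddAbove_distComplexity {n : ℕ} {ε : ℝ} (hε : 0 ≤ ε) (f : BoolFn n) :
    BddAbove (Set.range fun p : Fin n → unitInterval => distComplexity ε f (productDist p)) :=
  ⟨n, by rintro _ ⟨p, rfl⟩; exact distComplexity_le hε f _⟩

theorem discOn_le {n : ℕ} (f : BoolFn n) (μ : Dist n) : discOn f μ ≤ n := by
  classical
  obtain ⟨x, hx⟩ : ∃ x : Cube n, (2 ^ n : ℝ)⁻¹ ≤ μ.1 x := by
    by_contra! h
    have h1 : ∑ x : Cube n, μ.1 x < ∑ _x : Cube n, (2 ^ n : ℝ)⁻¹ :=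
      Finset.sum_lt_sum_of_nonempty Finset.univ_nonempty fun x _ => h x
    rw [μ.2.2] at h1
    simp [ZMod.card] at h1
  have hb : (2 ^ n : ℝ)⁻¹ ≤ bias f μ (AffineSubspace.mk' x ⊥) := by
    have hS : ∀ y, y ∈ AffineSubspace.mk' x (⊥ : Submodule (ZMod 2) (Cube n)) ↔ y = x := by
      intro y
      simp [AffineSubspace.mem_mk', sub_eq_zero]
    have h0 := μ.2.1 x
    simp only [bias, hS, Finset.sum_ite_eq', Finset.mem_univ, if_true]
    split_ifs <;> simp [abs_of_nonneg h0] <;> simpa using hx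
  have hle : (2 ^ n : ℝ)⁻¹ ≤ ⨆ S : AffineSubspace (ZMod 2) (Cube n), bias f μ S := by
    have : Finite (AffineSubspace (ZMod 2) (Cube n)) :=
      Finite.of_injective (fun S => (S : Set (Cube n))) SetLike.coe_injective
    exact hb.trans (le_ciSup (Set.finite_range _).bddAbove _)
  have h2 := Real.logb_le_logb_of_le (b := 2) (by norm_num) (by positivity) hle
  rw [Real.logb_inv, Real.logb_pow, Real.logb_self_eq_one (by norm_num)] at h2
  unfold discOn
  linarith

theorem bddAbove_discOn {n : ℕ} (f : BoolFn n) :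
    BddAbove (Set.range fun μ : Dist n => discOn f μ) :=
  ⟨n, by rintro _ ⟨μ, rfl⟩; exact discOn_le f μ⟩

/-! ### Majority and the random sparse function -/

/-- The majority function: `1` exactly when more than half of the bits are `1`. -/
def majority (n : ℕ) : BoolFn n :=
  fun x => decide (n < 2 * (Finset.univ.filter fun i => x i = 1).card)

/-- The density `2^{-0.9 n}`. -/
def sparseDensity (n : ℕ) : unitInterval :=
  ⟨(2 : ℝ) ^ (-(0.9 * (n : ℝ))), by positivity,
    Real.rpow_le_one_of_one_le_of_nonpos (by norm_num) (by
      have : (0 : ℝ) ≤ n := n.cast_nonneg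
      linarith)⟩

/-- The law of the random sparse function: the values `f(x)`, `x ∈ {0,1}ⁿ`, are independent, each
equal to `1` with probability `2^{-0.9 n}`. -/
def randomSparse (n : ℕ) : MeasureTheory.Measure (BoolFn n) :=
  MeasureTheory.Measure.pi fun _ : Cube n =>
    ProbabilityTheory.bernoulliMeasure true false (sparseDensity n)

end ParityTrees

end

noncomputable section

namespace ParityTrees


/-! ### Discrepancy: elementary bounds -/

/-! Majority is a linear threshold function, and `n + 1/2 - 2|x|` is a combination, with weights of
total size `O(n)`, of the indicators of the whole cube and of the hyperplanes `xᵢ = 1`. Under any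
distribution one of these has bias at least of order `1/n` (`exists_le_bias_majority`).

For the linear lower bound take the uniform distribution. A leaf of a depth-`d` tree is a coset of a
subspace `W` of codimension at most `d`, and `W` contains a vector `w` with a zero set `K` of at
most `d` coordinates (`exists_mem_card_zeros_le`). Translation by `w` stays in the leaf, so the
output is unchanged, but majority flips unless the total sum of signs is at most twice the sum over
`K` in absolute value. The total is typically of order `√n`. The trivial bound `d` on the sum over
`K` is too weak, so its second moment is bounded by `3d` instead (`ParityTree.sum_sq_sum_zeros_le`):
the mean of `pairSum` over all coordinates is `n` for every tree, and the coordinates outside `K`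
already account for `n - 3d` of it. Chebyshev and anticoncentration then force error above `1/3`
when `d` is a small multiple of `n`.

The random sparse function is `IsTypical` with high probability, by Chernoff and union bounds.
Uniformity on affine subspaces makes every bias exponentially small once half of the mass is put on
each of `f⁻¹(0)` and `f⁻¹(1)`. A product distribution is either so spread out that the ones of `f`
have negligible mass, or concentrated on a Hamming ball with fewer than 20 ones, which six random
parities recognize with small error. -/

theorem bddAbove_bias {n : ℕ} (f : BoolFn n) (μ : Dist n) :
    BddAbove (Set.range fun S : AffineSubspace (ZMod 2) (Cube n) => bias f μ S) := by
  have : Finite (AffineSubspace (ZMod 2) (Cube n)) :=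
    Finite.of_injective (fun S => (S : Set (Cube n))) SetLike.coe_injective
  exact (Set.finite_range _).bddAbove

theorem bias_le_one {n : ℕ} (f : BoolFn n) (μ : Dist n)
    (S : AffineSubspace (ZMod 2) (Cube n)) : bias f μ S ≤ 1 := by
  classical
  unfold bias
  refine (Finset.abs_sum_le_sum_abs _ _).trans ?_
  refine (Finset.sum_le_sum fun x _ => ?_).trans_eq μ.2.2
  have h := μ.2.1 x
  split_ifs <;> simp [abs_of_nonneg h, h]

theorem exists_bias_pos {n : ℕ} (f : BoolFn n) (μ : Dist n) :
    ∃ S : AffineSubspace (ZMod 2) (Cube n), 0 < bias f μ S := by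
  classical
  obtain ⟨x, hx⟩ : ∃ x : Cube n, 0 < μ.1 x := by
    by_contra! h
    have h1 := Finset.sum_nonpos fun x (_ : x ∈ Finset.univ) => h x
    rw [μ.2.2] at h1
    linarith
  refine ⟨AffineSubspace.mk' x ⊥, ?_⟩
  have hS : ∀ y, y ∈ AffineSubspace.mk' x (⊥ : Submodule (ZMod 2) (Cube n)) ↔ y = x := by
    intro y
    simp [AffineSubspace.mem_mk', sub_eq_zero]
  simp only [bias, hS, Finset.sum_ite_eq', Finset.mem_univ, if_true]
  split_ifs <;> simp [hx.ne']

theorem discOn_le_of_le_bias {n : ℕ} {f : BoolFn n} {μ : Dist n} {b : ℝ} (hb : 0 < b)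
    {S : AffineSubspace (ZMod 2) (Cube n)} (h : b ≤ bias f μ S) :
    discOn f μ ≤ -Real.logb 2 b :=
  neg_le_neg (Real.logb_le_logb_of_le (by norm_num) hb (h.trans (le_ciSup (bddAbove_bias f μ) S)))

theorem le_discOn_of_bias_le {n : ℕ} {f : BoolFn n} {μ : Dist n} {b : ℝ}
    (h : ∀ S, bias f μ S ≤ b) : -Real.logb 2 b ≤ discOn f μ := by
  obtain ⟨S, hS⟩ := exists_bias_pos f μ
  exact neg_le_neg (Real.logb_le_logb_of_le (by norm_num)
    (hS.trans_le (le_ciSup (bddAbove_bias f μ) S)) (ciSup_le h))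

theorem discOn_nonneg {n : ℕ} (f : BoolFn n) (μ : Dist n) : 0 ≤ discOn f μ := by
  simpa using le_discOn_of_bias_le (bias_le_one f μ)

instance {n : ℕ} : Nonempty (Dist n) := ⟨productDist fun _ => 0⟩

theorem disc_nonneg {n : ℕ} (f : BoolFn n) : 0 ≤ disc f :=
  Real.iSup_nonneg fun μ => discOn_nonneg f μ

theorem disc_le {n : ℕ} (f : BoolFn n) : disc f ≤ n :=
  ciSup_le fun μ => discOn_le f μ

/-! ### The discrepancy of majority -/

open Classical in
/-- The signed sum `∑_{x ∈ S} (-1)^{f(x)} μ(x)`. -/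
def signedSum {n : ℕ} (f : BoolFn n) (μ : Dist n) (S : AffineSubspace (ZMod 2) (Cube n)) : ℝ :=
  ∑ x : Cube n, if x ∈ S then (if f x then (-1 : ℝ) else 1) * μ.1 x else 0

/-- The affine hyperplane `xᵢ = 1`. -/
def coordOne {n : ℕ} (i : Fin n) : AffineSubspace (ZMod 2) (Cube n) :=
  AffineSubspace.mk' (Pi.single i 1) (LinearMap.ker (LinearMap.proj i))

theorem mem_coordOne {n : ℕ} (i : Fin n) (x : Cube n) : x ∈ coordOne i ↔ x i = 1 := by
  simp [coordOne, AffineSubspace.mem_mk', sub_eq_zero]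

/-- The form `n + 1/2 - 2|x|` has the sign of `(-1)^MAJ` and absolute value at least `1/2`, so its
correlation with that sign is at least `1/2`. Its coefficients have total size `(n + 1/2) + 2n = (6n
+ 1)/2`, which gives the constant. -/
theorem exists_le_bias_majority {n : ℕ} (μ : Dist n) :
    ∃ S, (6 * n + 1 : ℝ)⁻¹ ≤ bias (majority n) μ S := by
  classical
  by_contra! h
  set β : ℝ := (6 * n + 1 : ℝ)⁻¹ with hβ
  have hs : ∀ S, |signedSum (majority n) μ S| < β := h
  have key : (1 / 2 : ℝ) ≤ (n + 1 / 2) * signedSum (majority n) μ ⊤ -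
      2 * ∑ i : Fin n, signedSum (majority n) μ (coordOne i) := by
    have e : (n + 1 / 2) * signedSum (majority n) μ ⊤ -
        2 * ∑ i : Fin n, signedSum (majority n) μ (coordOne i) =
        ∑ x : Cube n, ((n + 1 / 2) - 2 * ((Finset.univ.filter fun i => x i = 1).card : ℝ)) *
          ((if majority n x then (-1 : ℝ) else 1) * μ.1 x) := by
      simp only [signedSum, AffineSubspace.mem_top, if_true, mem_coordOne]
      rw [Finset.sum_comm, Finset.mul_sum, Finset.mul_sum, ← Finset.sum_sub_distrib]
      refine Finset.sum_congr rfl fun x _ => ?_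
      rw [← Finset.sum_filter, Finset.sum_const, nsmul_eq_mul]
      ring
    rw [e]
    calc (1 / 2 : ℝ) = ∑ x : Cube n, 1 / 2 * μ.1 x := by rw [← Finset.mul_sum, μ.2.2, mul_one]
      _ ≤ _ := Finset.sum_le_sum fun x _ => ?_
    rw [← mul_assoc]
    refine mul_le_mul_of_nonneg_right ?_ (μ.2.1 x)
    by_cases hx : n < 2 * (Finset.univ.filter fun i => x i = 1).card
    · have : (n : ℝ) + 1 ≤ 2 * ((Finset.univ.filter fun i => x i = 1).card : ℝ) := by
        exact_mod_cast hx
      simp only [majority, hx, decide_true, if_true]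
      linarith
    · have : 2 * ((Finset.univ.filter fun i => x i = 1).card : ℝ) ≤ n := by
        exact_mod_cast not_lt.1 hx
      simp only [majority, hx, decide_false, if_false, Bool.false_eq_true]
      linarith
  have h1 : (n + 1 / 2) * signedSum (majority n) μ ⊤ < (n + 1 / 2) * β :=
    mul_lt_mul_of_pos_left (abs_lt.1 (hs ⊤)).2 (by positivity)
  have h2 : -(n * β) ≤ ∑ i : Fin n, signedSum (majority n) μ (coordOne i) := by
    have := Finset.sum_le_sum fun i (_ : i ∈ (Finset.univ : Finset (Fin n))) =>
      (abs_lt.1 (hs (coordOne i))).1.le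
    simpa using this
  have h3 : (6 * n + 1) * β = 1 := mul_inv_cancel₀ (by positivity)
  linarith

theorem disc_majority_le (n : ℕ) : disc (majority n) ≤ Real.logb 2 (6 * n + 1) := by
  refine ciSup_le fun μ => ?_
  obtain ⟨S, hS⟩ := exists_le_bias_majority μ
  simpa [Real.logb_inv] using discOn_le_of_le_bias (by positivity) hS

theorem disc_majority_isBigO :
    (fun n : ℕ => disc (majority n)) =O[atTop] (fun n : ℕ => Real.log (n : ℝ)) := by
  refine IsBigO.of_bound (4 / Real.log 2) ?_
  filter_upwards [eventually_ge_atTop 7] with n hn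
  have hn' : (7 : ℝ) ≤ n := by exact_mod_cast hn
  have hl : 0 < Real.log 2 := Real.log_pos (by norm_num)
  rw [Real.norm_of_nonneg (disc_nonneg _), Real.norm_of_nonneg (Real.log_nonneg (by linarith))]
  refine (disc_majority_le n).trans ?_
  rw [Real.logb, div_mul_eq_mul_div]
  refine div_le_div_of_nonneg_right ?_ hl.le
  rw [show (4 : ℝ) * Real.log n = Real.log ((n : ℝ) ^ 4) by rw [Real.log_pow]; norm_num]
  refine Real.log_le_log (by positivity) ?_
  nlinarith [mul_le_mul hn' hn' (by norm_num) (by linarith), sq_nonneg ((n : ℝ) ^ 2)]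


/-! ### Linear directions of the leaves of a parity tree -/

/-- The sign `(-1)^b`. -/
def sgn (b : ZMod 2) : ℝ := if b = 1 then -1 else 1

theorem zmod_two_eq (b : ZMod 2) : b = 0 ∨ b = 1 := by
  revert b; decide

@[simp] theorem sgn_zero : sgn 0 = 1 := by simp [sgn]

@[simp] theorem sgn_one : sgn 1 = -1 := by simp [sgn]

theorem sgn_mul_self (b : ZMod 2) : sgn b * sgn b = 1 := by
  rcases zmod_two_eq b with rfl | rfl <;> simp

theorem sgn_add_one (b : ZMod 2) : sgn (b + 1) = -sgn b := by
  rcases zmod_two_eq b with rfl | rfl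
  · simp
  · rw [show (1 + 1 : ZMod 2) = 0 by decide]; simp

theorem cube_add_cancel {n : ℕ} (x w : Cube n) : x + w + w = x := by
  funext i
  simp [add_assoc, CharTwo.add_self_eq_zero]

/-- The coordinates `i` and `j` agree on the subspace `W`. -/
def CoordEq {n : ℕ} (W : Submodule (ZMod 2) (Cube n)) (i j : Fin n) : Prop :=
  ∀ w ∈ W, w i = w j

/-- The vectors orthogonal to `a`. -/
def orth {n : ℕ} (a : Cube n) : Submodule (ZMod 2) (Cube n) where
  carrier := {x | a ⬝ᵥ x = 0}
  add_mem' {x y} hx hy := by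
    simp only [Set.mem_ofPred_eq] at *
    rw [dotProduct_add, hx, hy, add_zero]
  zero_mem' := by simp
  smul_mem' c x hx := by
    simp only [Set.mem_ofPred_eq] at *
    rw [dotProduct_smul, hx, smul_zero]

theorem mem_orth {n : ℕ} {a x : Cube n} : x ∈ orth a ↔ a ⬝ᵥ x = 0 := Iff.rfl

/-- The direction of the leaf that `x` reaches, when the tree is run on a coset of `W`. -/
def ParityTree.leafDir {n : ℕ} :
    ParityTree n → Submodule (ZMod 2) (Cube n) → Cube n → Submodule (ZMod 2) (Cube n)
  | .leaf _, W, _ => W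
  | .query a t₀ t₁, W, x =>
      if a ⬝ᵥ x = 0 then t₀.leafDir (W ⊓ orth a) x else t₁.leafDir (W ⊓ orth a) x

/-- `V` is a union of cosets of `W`. -/
def Invariant {n : ℕ} (V : Finset (Cube n)) (W : Submodule (ZMod 2) (Cube n)) : Prop :=
  ∀ x ∈ V, ∀ w ∈ W, x + w ∈ V

theorem Invariant.filter {n : ℕ} {V : Finset (Cube n)} {W : Submodule (ZMod 2) (Cube n)}
    (h : Invariant V W) (a : Cube n) (p : ZMod 2 → Prop) [DecidablePred p] :
    Invariant (V.filter fun x => p (a ⬝ᵥ x)) (W ⊓ orth a) := by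
  intro x hx w hw
  rw [Finset.mem_filter] at hx ⊢
  refine ⟨h x hx.1 w hw.1, ?_⟩
  rw [dotProduct_add, mem_orth.1 hw.2, add_zero]
  exact hx.2

theorem ParityTree.leafDir_le {n : ℕ} (T : ParityTree n) (W : Submodule (ZMod 2) (Cube n))
    (x : Cube n) : T.leafDir W x ≤ W := by
  induction T generalizing W with
  | leaf b => exact le_rfl
  | query a t₀ t₁ ih₀ ih₁ =>
    simp only [ParityTree.leafDir]
    split_ifs
    · exact (ih₀ _).trans inf_le_left
    · exact (ih₁ _).trans inf_le_left

/-- A vector of the leaf's direction is orthogonal to every parity queried on the path, so the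
translate follows the same path. This makes translation by a vector chosen from the leaf direction
an involution. -/
theorem ParityTree.eval_leafDir_add {n : ℕ} (T : ParityTree n)
    (W : Submodule (ZMod 2) (Cube n)) (x w : Cube n) (hw : w ∈ T.leafDir W x) :
    T.eval (x + w) = T.eval x ∧ T.leafDir W (x + w) = T.leafDir W x := by
  induction T generalizing W with
  | leaf b => exact ⟨rfl, rfl⟩
  | query a t₀ t₁ ih₀ ih₁ =>
    have ha : a ⬝ᵥ (x + w) = a ⬝ᵥ x := by
      have : w ∈ orth a := by
        simp only [ParityTree.leafDir] at hw
        split_ifs at hw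
        · exact (t₀.leafDir_le _ x hw).2
        · exact (t₁.leafDir_le _ x hw).2
      rw [dotProduct_add, mem_orth.1 this, add_zero]
    simp only [ParityTree.leafDir, ParityTree.eval, ha] at hw ⊢
    split_ifs at hw ⊢
    · exact ih₀ _ hw
    · exact ih₁ _ hw

theorem finrank_le_inf_orth {n : ℕ} (W : Submodule (ZMod 2) (Cube n)) (a : Cube n) :
    Module.finrank (ZMod 2) W ≤ Module.finrank (ZMod 2) ↥(W ⊓ orth a) + 1 := by
  let φ : W →ₗ[ZMod 2] ZMod 2 :=
    { toFun := fun x => a ⬝ᵥ (x : Cube n)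
      map_add' := fun x y => by simp [dotProduct_add]
      map_smul' := fun c x => by simp [dotProduct_smul] }
  have h1 := LinearMap.finrank_range_add_finrank_ker φ
  have h2 : Module.finrank (ZMod 2) (LinearMap.range φ) ≤ 1 :=
    (Submodule.finrank_le _).trans_eq (Module.finrank_self _)
  have h3 : (LinearMap.ker φ).map W.subtype = W ⊓ orth a := by
    ext x
    simp only [Submodule.mem_map, LinearMap.mem_ker, Submodule.mem_inf]
    constructor
    · rintro ⟨y, hy, rfl⟩
      exact ⟨y.2, hy⟩
    · rintro ⟨hx, hx'⟩
      exact ⟨⟨x, hx⟩, hx', rfl⟩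
  have h4 := W.finrank_map_subtype_eq (LinearMap.ker φ)
  rw [h3] at h4
  omega

theorem ParityTree.finrank_leafDir {n : ℕ} (T : ParityTree n)
    (W : Submodule (ZMod 2) (Cube n)) (x : Cube n) :
    Module.finrank (ZMod 2) W ≤ Module.finrank (ZMod 2) (T.leafDir W x) + T.depth := by
  induction T generalizing W with
  | leaf b => exact le_rfl
  | query a t₀ t₁ ih₀ ih₁ =>
    have h := finrank_le_inf_orth W a
    have h₀ := ih₀ (W ⊓ orth a)
    have h₁ := ih₁ (W ⊓ orth a)
    simp only [ParityTree.depth]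
    by_cases hx : a ⬝ᵥ x = 0
    · have e : (ParityTree.query a t₀ t₁).leafDir W x = t₀.leafDir (W ⊓ orth a) x := if_pos hx
      rw [e]
      omega
    · have e : (ParityTree.query a t₀ t₁).leafDir W x = t₁.leafDir (W ⊓ orth a) x := if_neg hx
      rw [e]
      omega

/-- A leafwise inequality between sums gives an inequality over the whole cube. -/
theorem ParityTree.sum_leafDir_le {n : ℕ} (T : ParityTree n)
    (F G : Submodule (ZMod 2) (Cube n) → Cube n → ℝ) (P : Submodule (ZMod 2) (Cube n) → Prop)
    (hFG : ∀ W V, P W → Invariant V W → ∑ x ∈ V, F W x ≤ ∑ x ∈ V, G W x)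
    (W : Submodule (ZMod 2) (Cube n)) (V : Finset (Cube n)) (hV : Invariant V W)
    (hP : ∀ x ∈ V, P (T.leafDir W x)) :
    ∑ x ∈ V, F (T.leafDir W x) x ≤ ∑ x ∈ V, G (T.leafDir W x) x := by
  induction T generalizing W V with
  | leaf b =>
    -- `P W` is only known for leaves that some point of `V` reaches.
    rcases V.eq_empty_or_nonempty with rfl | ⟨x, hx⟩
    · simp
    · exact hFG W V (hP x hx) hV
  | query a t₀ t₁ ih₀ ih₁ =>
    rw [← Finset.sum_filter_add_sum_filter_not V (fun x => a ⬝ᵥ x = 0),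
      ← Finset.sum_filter_add_sum_filter_not V (fun x => a ⬝ᵥ x = 0)
        (fun x => G _ x)]
    have h₀ : ∀ x ∈ V.filter fun x => a ⬝ᵥ x = 0,
        (ParityTree.query a t₀ t₁).leafDir W x = t₀.leafDir (W ⊓ orth a) x := fun x hx => by
      simp only [ParityTree.leafDir, (Finset.mem_filter.1 hx).2, if_true]
    have h₁ : ∀ x ∈ V.filter fun x => ¬ a ⬝ᵥ x = 0,
        (ParityTree.query a t₀ t₁).leafDir W x = t₁.leafDir (W ⊓ orth a) x := fun x hx => by
      simp only [ParityTree.leafDir, (Finset.mem_filter.1 hx).2, if_false]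
    refine add_le_add ?_ ?_
    · rw [Finset.sum_congr rfl fun x hx => congrArg (F · x) (h₀ x hx),
        Finset.sum_congr rfl fun x hx => congrArg (G · x) (h₀ x hx)]
      exact ih₀ _ _ (hV.filter a (· = 0)) fun x hx => h₀ x hx ▸ hP x (Finset.mem_filter.1 hx).1
    · rw [Finset.sum_congr rfl fun x hx => congrArg (F · x) (h₁ x hx),
        Finset.sum_congr rfl fun x hx => congrArg (G · x) (h₁ x hx)]
      exact ih₁ _ _ (hV.filter a (¬ · = 0)) fun x hx => h₁ x hx ▸ hP x (Finset.mem_filter.1 hx).1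

/-! ### Second moments on the leaves -/

/-- Translation by some `w ∈ W` with `w i ≠ w j` is an involution of `V` that reverses the sign of
every term. -/
theorem sum_sgn_mul_sgn_eq_zero {n : ℕ} {V : Finset (Cube n)}
    {W : Submodule (ZMod 2) (Cube n)} (hV : Invariant V W) {i j : Fin n}
    (hij : ¬ CoordEq W i j) : ∑ x ∈ V, sgn (x i) * sgn (x j) = 0 := by
  unfold CoordEq at hij
  push Not at hij
  obtain ⟨w, hw, hne⟩ := hij
  refine Finset.sum_involution (fun x _ => x + w) ?_ ?_ ?_ ?_
  · intro x _
    simp only [Pi.add_apply]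
    rcases zmod_two_eq (w i) with hi | hi <;> rcases zmod_two_eq (w j) with hj | hj
    · exact absurd (hi.trans hj.symm) hne
    · rw [hi, hj, sgn_add_one]; simp
    · rw [hi, hj, sgn_add_one]; simp
    · exact absurd (hi.trans hj.symm) hne
  · intro x _ _ h
    have : w = 0 := by simpa using h
    simp [this] at hne
  · exact fun x hx => hV x hx w hw
  · exact fun x _ => cube_add_cancel x w

open Classical in
/-- The sum of `(-1)^{xᵢ + xⱼ}` over the pairs in `s` of coordinates that agree on `W`. -/
def pairSum {n : ℕ} (s : Finset (Fin n)) (W : Submodule (ZMod 2) (Cube n)) (x : Cube n) : ℝ :=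
  ∑ i ∈ s, ∑ j ∈ s, if CoordEq W i j then sgn (x i) * sgn (x j) else 0

/-- Restricting to a subspace creates new pairs, but those average to zero. -/
theorem sum_pairSum_eq {n : ℕ} {V : Finset (Cube n)} {W W' : Submodule (ZMod 2) (Cube n)}
    (hV : Invariant V W) (hW : W' ≤ W) (s : Finset (Fin n)) :
    ∑ x ∈ V, pairSum s W' x = ∑ x ∈ V, pairSum s W x := by
  classical
  simp only [pairSum]
  rw [Finset.sum_comm, Finset.sum_comm (s := V)]
  refine Finset.sum_congr rfl fun i _ => ?_
  rw [Finset.sum_comm, Finset.sum_comm (s := V)]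
  refine Finset.sum_congr rfl fun j _ => ?_
  by_cases h : CoordEq W i j
  · have h' : CoordEq W' i j := fun w hw => h w (hW hw)
    simp [h, h']
  · by_cases h' : CoordEq W' i j
    · simp [h, h', sum_sgn_mul_sgn_eq_zero hV h]
    · simp [h, h']

theorem coordEq_bot {n : ℕ} (i j : Fin n) : CoordEq (⊥ : Submodule (ZMod 2) (Cube n)) i j := by
  intro w hw
  simp [(Submodule.mem_bot _).1 hw]

/-- On a coset, the square of a sum of signs averages to the sum over the agreeing pairs. -/
theorem sum_sq_sum_sgn {n : ℕ} {V : Finset (Cube n)} {W : Submodule (ZMod 2) (Cube n)}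
    (hV : Invariant V W) (s : Finset (Fin n)) :
    ∑ x ∈ V, (∑ i ∈ s, sgn (x i)) ^ 2 = ∑ x ∈ V, pairSum s W x := by
  -- All coordinates agree on the zero subspace, so `pairSum s ⊥` is the full square.
  rw [← sum_pairSum_eq hV bot_le]
  refine Finset.sum_congr rfl fun x _ => ?_
  simp only [pairSum, coordEq_bot, if_true]
  rw [sq, Finset.sum_mul_sum]

/-- A conservation law: the pairs that a query newly makes agree average to zero over the set on
which it is asked, so the total is the one at the root. -/
theorem ParityTree.sum_pairSum_leafDir {n : ℕ} (T : ParityTree n) (s : Finset (Fin n))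
    (W : Submodule (ZMod 2) (Cube n)) (V : Finset (Cube n)) (hV : Invariant V W) :
    ∑ x ∈ V, pairSum s (T.leafDir W x) x = ∑ x ∈ V, pairSum s W x := by
  induction T generalizing W V with
  | leaf b => rfl
  | query a t₀ t₁ ih₀ ih₁ =>
    rw [← sum_pairSum_eq hV inf_le_left (W' := W ⊓ orth a),
      ← Finset.sum_filter_add_sum_filter_not V (fun x => a ⬝ᵥ x = 0),
      ← Finset.sum_filter_add_sum_filter_not V (fun x => a ⬝ᵥ x = 0)
        (fun x => pairSum s (W ⊓ orth a) x),
      ← ih₀ _ _ (hV.filter a (· = 0)), ← ih₁ _ _ (hV.filter a (¬ · = 0))]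
    congr 1
    · refine Finset.sum_congr rfl fun x hx => ?_
      simp only [ParityTree.leafDir, (Finset.mem_filter.1 hx).2, if_true]
    · refine Finset.sum_congr rfl fun x hx => ?_
      simp only [ParityTree.leafDir, (Finset.mem_filter.1 hx).2, if_false]

theorem pairSum_top {n : ℕ} (x : Cube n) : pairSum Finset.univ ⊤ x = n := by
  classical
  have h : ∀ i j : Fin n, CoordEq (⊤ : Submodule (ZMod 2) (Cube n)) i j ↔ i = j := by
    intro i j
    constructor
    · intro h
      by_contra hij
      have := h (Pi.single i 1) trivial
      simp [Ne.symm hij] at this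
    · rintro rfl w _
      rfl
  simp [pairSum, h, sgn_mul_self]

/-! ### A vector with few zeros in a subspace of small codimension -/

/-- Take `w` with the fewest zeros. If its zero set `K` had more than `d` elements, restriction to
`Kᶜ` would have a nonzero kernel on `W`; a nonzero `z ∈ W` supported in `K` could be added to `w` to
remove zeros. -/
theorem exists_mem_card_zeros_le {n d : ℕ} (W : Submodule (ZMod 2) (Cube n))
    (hd : n ≤ Module.finrank (ZMod 2) W + d) :
    ∃ w ∈ W, (Finset.univ.filter fun i => w i = 0).card ≤ d := by
  classical
  obtain ⟨w, hw, hmin⟩ := Set.exists_min_image (W : Set (Cube n))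
    (fun w => (Finset.univ.filter fun i => w i = 0).card) (Set.toFinite _) ⟨0, W.zero_mem⟩
  refine ⟨w, hw, ?_⟩
  by_contra! hlt
  set K := Finset.univ.filter fun i => w i = 0 with hK
  let φ : W →ₗ[ZMod 2] ((Kᶜ : Finset (Fin n)) → ZMod 2) :=
    (LinearMap.funLeft (ZMod 2) (ZMod 2) Subtype.val).comp W.subtype
  have hφ : LinearMap.ker φ ≠ ⊥ := by
    refine LinearMap.ker_ne_bot_of_finrank_lt ?_
    have := K.card_add_card_compl
    rw [Fintype.card_fin] at this
    rw [Module.finrank_fintype_fun_eq_card, Fintype.card_coe]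
    omega
  obtain ⟨⟨z, hzW⟩, hzφ, hz'⟩ := (Submodule.ne_bot_iff _).1 hφ
  have hz : z ≠ 0 := fun h => hz' (Subtype.ext h)
  have hzK : ∀ i, i ∉ K → z i = 0 := fun i hi =>
    congrFun (LinearMap.mem_ker.1 hzφ) ⟨i, Finset.mem_compl.2 hi⟩
  obtain ⟨i, hi⟩ := Function.ne_iff.1 hz
  have hiK : i ∈ K := by
    by_contra h
    exact hi (hzK i h)
  refine absurd (hmin (w + z) (W.add_mem hw hzW)) (not_le.2 ?_)
  refine Finset.card_lt_card (Finset.ssubset_iff_of_subset ?_ |>.2 ⟨i, hiK, ?_⟩)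
  · intro j hj
    by_contra hjK
    have h1 : w j ≠ 0 := by simpa [hK] using hjK
    simp [hzK j hjK, h1] at hj
  · have h1 : w i = 0 := by simpa [hK] using hiK
    simpa [h1] using hi


/-! ### Leaves of small codimension -/

theorem two_sub_card_le_sq_sum_sgn {ι : Type*} {F : Finset ι} (hF : F.Nonempty)
    (y : ι → ZMod 2) : 2 - (F.card : ℝ) ≤ (∑ i ∈ F, sgn (y i)) ^ 2 := by
  have h1 : 1 ≤ F.card := hF.card_pos
  rcases h1.eq_or_lt with h | h
  · obtain ⟨i, rfl⟩ := Finset.card_eq_one.1 h.symm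
    simp only [Finset.card_singleton, Finset.sum_singleton, sq, sgn_mul_self]
    norm_num
  · have : (2 : ℝ) ≤ F.card := by exact_mod_cast h
    nlinarith [sq_nonneg (∑ i ∈ F, sgn (y i))]

/-- `pairSum` is a sum of squares, one for each class of coordinates of `s` that agree on `W`. A
singleton class contributes exactly 1, and there are many classes because `W` has small codimension;
the bound `2 - |F|` per class `F` turns this count into a lower bound. -/
theorem le_pairSum {n d : ℕ} (W : Submodule (ZMod 2) (Cube n))
    (hd : n ≤ Module.finrank (ZMod 2) W + d) {s : Finset (Fin n)} (hs : sᶜ.card ≤ d)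
    (x : Cube n) : (n : ℝ) - 3 * d ≤ pairSum s W x := by
  classical
  let q : Fin n → W → ZMod 2 := fun i w => w.1 i
  have hq : ∀ i j, CoordEq W i j ↔ q j = q i := fun i j =>
    ⟨fun h => funext fun w => (h w.1 w.2).symm, fun h w hw => (congrFun h ⟨w, hw⟩).symm⟩
  have hsum : pairSum s W x =
      ∑ c ∈ s.image q, (∑ i ∈ s.filter fun i => q i = c, sgn (x i)) ^ 2 := by
    unfold pairSum
    rw [← Finset.sum_fiberwise_of_maps_to (t := s.image q) (g := q)
      (fun i hi => Finset.mem_image_of_mem q hi)]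
    refine Finset.sum_congr rfl fun c _ => ?_
    rw [sq, Finset.sum_mul]
    refine Finset.sum_congr rfl fun i hi => ?_
    rw [Finset.mul_sum, Finset.sum_filter]
    refine Finset.sum_congr rfl fun j _ => ?_
    simp only [hq, (Finset.mem_filter.1 hi).2]
  -- Vectors of `W` are constant on the classes, so `W` lies in the image of the functions on the
  -- set of classes.
  have hrank : Module.finrank (ZMod 2) W ≤ (Finset.univ.image q).card := by
    let ψ : ({c // c ∈ Finset.univ.image q} → ZMod 2) →ₗ[ZMod 2] Cube n :=
      LinearMap.funLeft (ZMod 2) (ZMod 2)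
        fun i => ⟨q i, Finset.mem_image_of_mem q (Finset.mem_univ i)⟩
    have hW : W ≤ LinearMap.range ψ := fun w hw => ⟨fun c => c.1 ⟨w, hw⟩, rfl⟩
    have h1 := (Submodule.finrank_mono hW).trans (LinearMap.finrank_range_le ψ)
    rwa [Module.finrank_fintype_fun_eq_card, Fintype.card_coe] at h1
  have himage : (Finset.univ.image q).card ≤ (s.image q).card + sᶜ.card := by
    rw [← Finset.union_compl s, Finset.image_union]
    exact (Finset.card_union_le _ _).trans (Nat.add_le_add_left Finset.card_image_le _)
  have hcard : s.card + sᶜ.card = n := by rw [Finset.card_add_card_compl, Fintype.card_fin]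
  have hfib : s.card = ∑ c ∈ s.image q, (s.filter fun i => q i = c).card :=
    Finset.card_eq_sum_card_image q s
  have hlow : ∑ c ∈ s.image q, (2 - ((s.filter fun i => q i = c).card : ℝ)) ≤ pairSum s W x := by
    rw [hsum]
    refine Finset.sum_le_sum fun c hc => two_sub_card_le_sq_sum_sgn ?_ x
    obtain ⟨i, hi, rfl⟩ := Finset.mem_image.1 hc
    exact ⟨i, Finset.mem_filter.2 ⟨hi, rfl⟩⟩
  rw [Finset.sum_sub_distrib, ← Nat.cast_sum, ← hfib, Finset.sum_const, nsmul_eq_mul] at hlow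
  refine le_trans ?_ hlow
  have h2 : n + s.card ≤ 2 * (s.image q).card + 3 * d := by omega
  have h3 : (n : ℝ) + s.card ≤ 2 * (s.image q).card + 3 * d := by exact_mod_cast h2
  linarith

theorem pairSum_univ_eq {n : ℕ} {W : Submodule (ZMod 2) (Cube n)} {s : Finset (Fin n)}
    (hs : ∀ i j, CoordEq W i j → (i ∈ s ↔ j ∈ s)) (x : Cube n) :
    pairSum Finset.univ W x = pairSum s W x + pairSum sᶜ W x := by
  classical
  unfold pairSum
  rw [← Finset.sum_add_sum_compl s]
  congr 1
  · refine Finset.sum_congr rfl fun i hi => ?_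
    rw [← Finset.sum_add_sum_compl s, add_eq_left]
    refine Finset.sum_eq_zero fun j hj => if_neg fun h => ?_
    exact Finset.mem_compl.1 hj ((hs i j h).1 hi)
  · refine Finset.sum_congr rfl fun i hi => ?_
    rw [← Finset.sum_add_sum_compl s, add_eq_right]
    refine Finset.sum_eq_zero fun j hj => if_neg fun h => ?_
    exact Finset.mem_compl.1 hi ((hs i j h).2 hj)

/-- The sum of signs over a small set of coordinates whose complement can be flipped inside the
leaf has small second moment. -/
theorem ParityTree.sum_sq_sum_zeros_le {n d : ℕ} (T : ParityTree n) (hT : T.depth ≤ d)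
    (w : Submodule (ZMod 2) (Cube n) → Cube n) (hw : ∀ W, w W ∈ W)
    (hcard : ∀ W : Submodule (ZMod 2) (Cube n), n ≤ Module.finrank (ZMod 2) W + d →
      (Finset.univ.filter fun i => w W i = 0).card ≤ d) :
    ∑ x : Cube n, (∑ i with w (T.leafDir ⊤ x) i = 0, sgn (x i)) ^ 2 ≤ 3 * d * 2 ^ n := by
  have hinv : Invariant (Finset.univ : Finset (Cube n)) ⊤ := fun _ _ _ _ => Finset.mem_univ _
  have key := T.sum_leafDir_le
    (fun W x => (∑ i with w W i = 0, sgn (x i)) ^ 2)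
    (fun W x => pairSum Finset.univ W x + (3 * d - n))
    (fun W => n ≤ Module.finrank (ZMod 2) W + d) ?_ ⊤ Finset.univ hinv ?_
  · refine key.trans ?_
    rw [Finset.sum_add_distrib, T.sum_pairSum_leafDir _ _ _ hinv, ← Finset.sum_add_distrib]
    simp only [pairSum_top]
    simp [ZMod.card, mul_comm]
  · intro W V hW hV
    rw [sum_sq_sum_sgn hV]
    refine Finset.sum_le_sum fun x _ => ?_
    -- As `w W ∈ W`, no agreeing pair straddles its zero set.
    have h1 := pairSum_univ_eq (W := W) (s := Finset.univ.filter fun i => w W i = 0)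
      (fun i j h => by simp [h _ (hw W)]) x
    have h2 := le_pairSum W hW (s := (Finset.univ.filter fun i => w W i = 0)ᶜ)
      (by rw [compl_compl]; exact hcard W hW) x
    linarith
  · intro x _
    have := T.finrank_leafDir ⊤ x
    rw [finrank_top, Module.finrank_fin_fun] at this
    omega

/-! ### Anticoncentration of the binomial distribution -/

/-- The extra factor `2k + 1` makes the induction close: the step reduces to `(2k + 1)(2k + 3) ≤ 4(k
+ 1)²`. -/
theorem centralBinom_sq_mul_le (k : ℕ) : k.centralBinom ^ 2 * (2 * k + 1) ≤ 16 ^ k := by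
  induction k with
  | zero => simp
  | succ k ih =>
    have h := Nat.succ_mul_centralBinom_succ k
    refine (Nat.mul_le_mul_left_iff (by positivity : 0 < (k + 1) ^ 2)).1 ?_
    calc (k + 1) ^ 2 * ((k + 1).centralBinom ^ 2 * (2 * (k + 1) + 1))
        = ((k + 1) * (k + 1).centralBinom) ^ 2 * (2 * k + 3) := by ring
      _ = (k.centralBinom ^ 2 * (2 * k + 1)) * (4 * (2 * k + 1) * (2 * k + 3)) := by rw [h]; ring
      _ ≤ 16 ^ k * (4 * (2 * k + 1) * (2 * k + 3)) := Nat.mul_le_mul_right _ ih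
      _ ≤ 16 ^ k * (16 * (k + 1) ^ 2) := Nat.mul_le_mul_left _ (by nlinarith)
      _ = _ := by ring

theorem choose_half_sq_mul_le (n : ℕ) : n.choose (n / 2) ^ 2 * n ≤ 4 ^ n := by
  obtain ⟨k, rfl | rfl⟩ := Nat.even_or_odd' n
  · have h := centralBinom_sq_mul_le k
    rw [Nat.mul_div_cancel_left k (by norm_num), pow_mul]
    rw [Nat.centralBinom] at h
    exact (Nat.mul_le_mul_left _ (Nat.le_succ _)).trans h
  · have h := centralBinom_sq_mul_le (k + 1)
    have h1 : (k + 1).centralBinom = 2 * (2 * k + 1).choose k := by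
      rw [Nat.centralBinom, show 2 * (k + 1) = 2 * k + 1 + 1 by ring, Nat.choose_succ_succ,
        ← Nat.choose_symm_half k]
      ring
    rw [show (2 * k + 1) / 2 = k by omega]
    rw [h1] at h
    have h2 : (16 : ℕ) ^ (k + 1) = 4 * 4 ^ (2 * k + 1) := by
      rw [show (16 : ℕ) = 4 ^ 2 by norm_num, ← pow_mul]; ring
    rw [h2] at h
    nlinarith [Nat.zero_le (((2 * k + 1).choose k) ^ 2)]

theorem card_filter_card_eq {n : ℕ} (k : ℕ) :
    (Finset.univ.filter fun x : Cube n =>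
      (Finset.univ.filter fun i => x i = 1).card = k).card = n.choose k := by
  classical
  have h : (Finset.powersetCard k (Finset.univ : Finset (Fin n))).card = n.choose k := by simp
  rw [← h]
  refine Finset.card_nbij' (fun x => Finset.univ.filter fun i => x i = 1)
    (fun s i => if i ∈ s then 1 else 0) ?_ ?_ ?_ ?_
  · intro x hx
    simpa [Finset.mem_powersetCard] using hx
  · intro s hs
    simpa [Finset.mem_powersetCard] using hs
  · intro x _
    funext i
    rcases zmod_two_eq (x i) with hi | hi <;> simp [hi]
  · intro s _
    ext i
    simp

theorem sum_sgn_eq {n : ℕ} (x : Cube n) :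
    ∑ i, sgn (x i) = n - 2 * ((Finset.univ.filter fun i => x i = 1).card : ℝ) := by
  have : ∀ i, sgn (x i) = 1 - 2 * (if x i = 1 then (1 : ℝ) else 0) := by
    intro i
    rcases zmod_two_eq (x i) with hi | hi <;> simp [hi]
    norm_num
  simp only [this, Finset.sum_sub_distrib, ← Finset.mul_sum, Finset.sum_boole]
  simp

theorem card_abs_sum_sgn_le {n : ℕ} (t : ℕ) :
    (Finset.univ.filter fun x : Cube n => |∑ i, sgn (x i)| ≤ 2 * t).card ≤
      (2 * t + 1) * n.choose (n / 2) := by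
  classical
  calc _ ≤ ((Finset.Icc (n / 2 - t) (n / 2 + t)).biUnion fun k =>
        Finset.univ.filter fun x : Cube n =>
          (Finset.univ.filter fun i => x i = 1).card = k).card := ?_
    _ ≤ ∑ k ∈ Finset.Icc (n / 2 - t) (n / 2 + t), n.choose k := by
        refine Finset.card_biUnion_le.trans_eq ?_
        exact Finset.sum_congr rfl fun k _ => card_filter_card_eq k
    _ ≤ ∑ _k ∈ Finset.Icc (n / 2 - t) (n / 2 + t), n.choose (n / 2) :=
        Finset.sum_le_sum fun k _ => Nat.choose_le_middle k n
    _ ≤ _ := by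
        rw [Finset.sum_const, smul_eq_mul, Nat.card_Icc]
        exact Nat.mul_le_mul_right _ (by omega)
  refine Finset.card_le_card fun x hx => ?_
  have hx' := (Finset.mem_filter.1 hx).2
  rw [sum_sgn_eq, abs_le] at hx'
  have h1 : 2 * (Finset.univ.filter fun i => x i = 1).card ≤ n + 2 * t := by
    have : 2 * ((Finset.univ.filter fun i => x i = 1).card : ℝ) ≤ n + 2 * t := by linarith
    exact_mod_cast this
  have h2 : n ≤ 2 * (Finset.univ.filter fun i => x i = 1).card + 2 * t := by
    have : (n : ℝ) ≤ 2 * ((Finset.univ.filter fun i => x i = 1).card : ℝ) + 2 * t := by linarith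
    exact_mod_cast this
  simp only [Finset.mem_biUnion, Finset.mem_filter, Finset.mem_univ, true_and, exists_eq_right',
    Finset.mem_Icc]
  omega


/-! ### Majority is hard for parity trees under the uniform distribution -/

/-- The uniform distribution on the cube. -/
def uniformDist (n : ℕ) : Dist n := productDist fun _ => ⟨1 / 2, by norm_num, by norm_num⟩

theorem uniformDist_apply {n : ℕ} (x : Cube n) : (uniformDist n).1 x = (2 ^ n : ℝ)⁻¹ := by
  have h : ∀ i : Fin n, (if x i = 1 then (1 / 2 : ℝ) else 1 - 1 / 2) = 2⁻¹ := by
    intro i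
    split_ifs <;> norm_num
  simp only [uniformDist, productDist, h]
  simp

theorem majority_eq_true_iff {n : ℕ} (x : Cube n) :
    majority n x = true ↔ ∑ i, sgn (x i) < 0 := by
  rw [sum_sgn_eq, majority, decide_eq_true_iff, sub_neg]
  exact_mod_cast Iff.rfl

/-- Flipping the coordinates outside a set `K` flips majority, unless the sum of all signs is
small compared with the sum of the signs in `K`. -/
theorem abs_sum_sgn_le_of_majority_eq {n : ℕ} {x w : Cube n}
    (h : majority n (x + w) = majority n x) :
    |∑ i, sgn (x i)| ≤ 2 * |∑ i with w i = 0, sgn (x i)| := by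
  have h0 : ∀ y : Cube n, ∑ i, sgn (y i) =
      ∑ i with w i = 0, sgn (y i) + ∑ i with ¬ w i = 0, sgn (y i) := fun y =>
    (Finset.sum_filter_add_sum_filter_not _ _ _).symm
  have h1 : ∑ i with w i = 0, sgn ((x + w) i) = ∑ i with w i = 0, sgn (x i) :=
    Finset.sum_congr rfl fun i hi => by simp [(Finset.mem_filter.1 hi).2]
  have h2 : ∑ i with ¬ w i = 0, sgn ((x + w) i) = -∑ i with ¬ w i = 0, sgn (x i) := by
    rw [← Finset.sum_neg_distrib]
    refine Finset.sum_congr rfl fun i hi => ?_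
    have := (zmod_two_eq (w i)).resolve_left (Finset.mem_filter.1 hi).2
    rw [Pi.add_apply, this, sgn_add_one]
  rw [Bool.eq_iff_iff, majority_eq_true_iff, majority_eq_true_iff, h0 x, h0 (x + w), h1, h2] at h
  rw [h0 x]
  generalize ∑ i with w i = 0, sgn (x i) = a at *
  generalize ∑ i with ¬ w i = 0, sgn (x i) = b at *
  have hb : |b| ≤ |a| := by
    by_cases hab : a + b < 0
    · have hab' := h.2 hab
      rw [abs_of_neg (by linarith : a < 0), abs_le]
      constructor <;> linarith
    · have hab' := mt h.1 hab
      rw [abs_of_nonneg (by linarith : 0 ≤ a), abs_le]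
      constructor <;> linarith
  linarith [abs_add_le a b]

/-- Pair `x` with its translate inside the leaf. If majority differs on the pair, the tree errs on
one of the two. Otherwise either the total sum of signs is at most `2t` (anticoncentration) or the
sum over the zero set exceeds `t` (Chebyshev). -/
theorem ParityTree.one_sub_le_two_mul_err_majority {n d : ℕ} (T : ParityTree n)
    (hT : T.depth ≤ d) {t : ℕ} (ht : 0 < t) :
    1 - (3 * d / t ^ 2 + (2 * t + 1) * n.choose (n / 2) / 2 ^ n) ≤
      2 * T.err (majority n) (uniformDist n) := by
  classical
  have hex : ∀ W : Submodule (ZMod 2) (Cube n), ∃ w ∈ W,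
      n ≤ Module.finrank (ZMod 2) W + d → (Finset.univ.filter fun i => w i = 0).card ≤ d := by
    intro W
    by_cases h : n ≤ Module.finrank (ZMod 2) W + d
    · obtain ⟨w, hw, hc⟩ := exists_mem_card_zeros_le W h
      exact ⟨w, hw, fun _ => hc⟩
    · exact ⟨0, W.zero_mem, fun h' => absurd h' h⟩
  choose w hw hcard using hex
  have hsq := T.sum_sq_sum_zeros_le hT w hw hcard
  set v : Cube n → Cube n := fun x => w (T.leafDir ⊤ x) with hv
  have hflip : ∀ x, T.eval (x + v x) = T.eval x ∧ v (x + v x) = v x := by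
    intro x
    obtain ⟨h1, h2⟩ := T.eval_leafDir_add ⊤ x (v x) (hw _)
    exact ⟨h1, by simp only [hv] at h2 ⊢; rw [h2]⟩
  let e : Cube n ≃ Cube n := Function.Involutive.toPerm (fun x => x + v x) fun x => by
    simp only [(hflip x).2, cube_add_cancel]
  let E : Cube n → ℝ := fun x => if T.eval x ≠ majority n x then 1 else 0
  have herr : T.err (majority n) (uniformDist n) = (∑ x, E x) / 2 ^ n := by
    simp only [ParityTree.err, uniformDist_apply, E, div_eq_mul_inv, Finset.sum_mul, ite_mul,
      one_mul, zero_mul]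
  have hpt : ∀ x, 1 ≤ E x + E (e x) + ((∑ i with v x i = 0, sgn (x i)) ^ 2 / t ^ 2 +
      if |∑ i, sgn (x i)| ≤ 2 * t then 1 else 0) := by
    intro x
    have hE : ∀ y, 0 ≤ E y := fun y => by simp only [E]; split_ifs <;> norm_num
    have hq : 0 ≤ (∑ i with v x i = 0, sgn (x i)) ^ 2 / (t : ℝ) ^ 2 := by positivity
    have hi : 0 ≤ if |∑ i, sgn (x i)| ≤ 2 * (t : ℝ) then (1 : ℝ) else 0 := by
      split_ifs <;> norm_num
    by_cases h : majority n (x + v x) = majority n x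
    · have h1 := abs_sum_sgn_le_of_majority_eq h
      by_cases h2 : |∑ i, sgn (x i)| ≤ 2 * (t : ℝ)
      · rw [if_pos h2]
        linarith [hE x, hE (e x)]
      · have h3 : (1 : ℝ) ≤ (∑ i with v x i = 0, sgn (x i)) ^ 2 / (t : ℝ) ^ 2 := by
          rw [one_le_div (by positivity), ← sq_abs (∑ i with v x i = 0, sgn (x i))]
          exact pow_le_pow_left₀ (by positivity) (by linarith) 2
        linarith [hE x, hE (e x)]
    · have h4 : 1 ≤ E x + E (e x) := by
        have he : e x = x + v x := rfl
        simp only [E, he, (hflip x).1]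
        by_cases h5 : T.eval x = majority n x
        · rw [if_neg (not_not.2 h5), if_pos (fun h6 => h (h6.symm.trans h5))]
          norm_num
        · rw [if_pos h5]
          split_ifs <;> norm_num
      linarith
  have hsum := Finset.sum_le_sum fun x (_ : x ∈ (Finset.univ : Finset (Cube n))) => hpt x
  rw [Finset.sum_add_distrib, Finset.sum_add_distrib, Finset.sum_add_distrib, e.sum_comp E,
    ← Finset.sum_div] at hsum
  have hN : ∑ _x : Cube n, (1 : ℝ) = 2 ^ n := by simp [ZMod.card]
  rw [hN] at hsum
  have hcount : (∑ x : Cube n, if |∑ i, sgn (x i)| ≤ 2 * (t : ℝ) then (1 : ℝ) else 0) ≤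
      (2 * t + 1) * n.choose (n / 2) := by
    rw [Finset.sum_boole]
    exact_mod_cast card_abs_sum_sgn_le t
  have hsq' : (∑ x : Cube n, (∑ i with v x i = 0, sgn (x i)) ^ 2) / (t : ℝ) ^ 2 ≤
      3 * d * 2 ^ n / t ^ 2 := div_le_div_of_nonneg_right hsq (by positivity)
  have hpow : (0 : ℝ) < 2 ^ n := by positivity
  rw [herr, ← mul_div_assoc, le_div_iff₀ hpow, sub_mul, add_mul, div_mul_cancel₀ _ hpow.ne']
  have : 3 * (d : ℝ) / t ^ 2 * 2 ^ n = 3 * d * 2 ^ n / t ^ 2 := by ring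
  linarith

theorem choose_half_div_le {n : ℕ} (hn : 0 < n) :
    (n.choose (n / 2) : ℝ) / 2 ^ n ≤ 1 / √n := by
  have h : ((n.choose (n / 2) : ℝ) * √n) ^ 2 ≤ (2 ^ n) ^ 2 := by
    rw [mul_pow, Real.sq_sqrt n.cast_nonneg, ← pow_mul, mul_comm n 2, pow_mul]
    norm_num
    exact_mod_cast choose_half_sq_mul_le n
  have h1 := abs_le_of_sq_le_sq' h (by positivity)
  have hs : 0 < √(n : ℝ) := Real.sqrt_pos.2 (by exact_mod_cast hn)
  rw [div_le_div_iff₀ (by positivity) hs]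
  linarith [h1.2]

theorem ParityTree.one_third_lt_err_majority {n : ℕ} (hn : 1600 ≤ n) (T : ParityTree n)
    (hT : 7680 * T.depth ≤ n) : 1 / 3 < T.err (majority n) (uniformDist n) := by
  have hn' : (1600 : ℝ) ≤ n := by exact_mod_cast hn
  have hT' : 7680 * (T.depth : ℝ) ≤ n := by exact_mod_cast hT
  set r := √(n : ℝ) with hr
  have hr0 : 40 ≤ r := Real.le_sqrt_of_sq_le (by linarith)
  have hr2 : r ^ 2 = n := Real.sq_sqrt n.cast_nonneg
  -- Since `7680 = 10 · 3 · 16²`, the Chebyshev term is at most `1/10`. The other term is at most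
  -- `1/8 + 3/√n ≤ 1/5` as `√n ≥ 40`. Hence twice the error is at least `7/10 > 2/3`.
  set t := ⌈r / 16⌉₊ with ht
  have ht1 : r / 16 ≤ t := Nat.le_ceil _
  have ht2 : (t : ℝ) < r / 16 + 1 := Nat.ceil_lt_add_one (by linarith)
  have ht0 : 0 < t := Nat.ceil_pos.2 (by linarith)
  have h := T.one_sub_le_two_mul_err_majority le_rfl ht0
  have h1 : 3 * (T.depth : ℝ) / t ^ 2 ≤ 1 / 10 := by
    rw [div_le_iff₀ (by positivity)]
    nlinarith
  have h2 : (2 * t + 1) * (n.choose (n / 2) : ℝ) / 2 ^ n ≤ 1 / 5 := by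
    rw [mul_div_assoc]
    refine (mul_le_mul_of_nonneg_left (choose_half_div_le (by omega)) (by positivity)).trans ?_
    rw [← hr, mul_one_div, div_le_iff₀ (by linarith)]
    linarith
  linarith

theorem le_prodComplexity_majority {n : ℕ} (hn : 1600 ≤ n) :
    n ≤ 7680 * prodComplexity (majority n) := by
  have hle : distComplexity (1 / 3) (majority n) (uniformDist n) ≤ prodComplexity (majority n) :=
    le_ciSup (bddAbove_distComplexity (by norm_num) (majority n)) _
  obtain ⟨T, hd, he⟩ : distComplexity (1 / 3) (majority n) (uniformDist n) ∈
      {d : ℕ | ∃ T : ParityTree n, T.depth = d ∧ T.err (majority n) (uniformDist n) ≤ 1 / 3} := by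
    refine Nat.sInf_mem ?_
    obtain ⟨T, -, he⟩ := exists_tree_of_dependsOn (Finset.univ : Finset (Fin n)) (majority n)
      (fun x y h => congrArg _ (funext fun i => h i (Finset.mem_univ i)))
    exact ⟨T.depth, T, rfl, by simp [ParityTree.err, he]⟩
  by_contra! hlt
  refine absurd he (not_le.2 (T.one_third_lt_err_majority hn ?_))
  omega

theorem prodComplexity_le_self {n : ℕ} (f : BoolFn n) : prodComplexity f ≤ n :=
  ciSup_le fun _ => distComplexity_le (by norm_num) f _

theorem prodComplexity_majority_isTheta :
    (fun n : ℕ => (prodComplexity (majority n) : ℝ)) =Θ[atTop] (fun n : ℕ => (n : ℝ)) := by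
  constructor
  · refine IsBigO.of_bound 1 (Eventually.of_forall fun n => ?_)
    simpa using prodComplexity_le_self (majority n)
  · refine IsBigO.of_bound 7680 ?_
    filter_upwards [eventually_ge_atTop 1600] with n hn
    simp only [Real.norm_natCast]
    exact_mod_cast le_prodComplexity_majority hn


/-! ### Sums of products over the cube and Hamming balls -/

theorem sum_prod_cube {n : ℕ} (g : Fin n → ZMod 2 → ℝ) :
    ∑ x : Cube n, ∏ i, g i (x i) = ∏ i, (g i 0 + g i 1) := by
  rw [← Fintype.prod_sum]
  refine Finset.prod_congr rfl fun i _ => ?_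
  have h2 : (Finset.univ : Finset (ZMod 2)) = {0, 1} := by decide
  rw [h2, Finset.sum_pair (by decide)]

theorem prod_ite_eq_pow_hammingDist {n : ℕ} (a : ℝ) (x c : Cube n) :
    ∏ i, (if x i = c i then 1 else a) = a ^ hammingDist x c := by
  rw [Finset.prod_ite, Finset.prod_const_one, one_mul, Finset.prod_const]
  rfl

/-- The Hamming ball of radius `n / 5` about `c`. -/
def hammingBall {n : ℕ} (c : Cube n) : Finset (Cube n) :=
  Finset.univ.filter fun x => 5 * hammingDist x c ≤ n

/-- Weight each point by `2^(-dist)`: the total is `(3/2)^n ≤ 2^(0.6n)`, since `(3/2)^5 ≤ 2^3`, and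
each point of the ball weighs at least `2^(-0.2n)`. -/
theorem card_hammingBall_le {n : ℕ} (c : Cube n) :
    ((hammingBall c).card : ℝ) ≤ 2 ^ (0.8 * (n : ℝ)) := by
  have h1 : ∑ x : Cube n, (1 / 2 : ℝ) ^ hammingDist x c = (3 / 2) ^ n := by
    simp only [← prod_ite_eq_pow_hammingDist]
    rw [sum_prod_cube (fun i b => if b = c i then (1 : ℝ) else 1 / 2)]
    rw [Finset.prod_congr rfl (g := fun _ => (3 / 2 : ℝ)) fun i _ => ?_]
    · rw [Finset.prod_const, Finset.card_univ, Fintype.card_fin]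
    · rcases zmod_two_eq (c i) with h | h <;> norm_num [h]
  have h2 : ((hammingBall c).card : ℝ) * 2 ^ (-(0.2 * (n : ℝ))) ≤ (3 / 2) ^ n := by
    rw [← h1, ← nsmul_eq_mul, ← Finset.sum_const]
    refine (Finset.sum_le_sum fun x hx => ?_).trans (Finset.sum_le_sum_of_subset_of_nonneg
      (Finset.subset_univ (hammingBall c)) fun x _ _ => by positivity)
    have hx' : 5 * (hammingDist x c : ℝ) ≤ n := by exact_mod_cast (Finset.mem_filter.1 hx).2
    rw [one_div, inv_pow, ← Real.rpow_natCast, ← Real.rpow_neg (by norm_num)]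
    exact Real.rpow_le_rpow_of_exponent_le (by norm_num) (by linarith)
  have h3 : (3 / 2 : ℝ) ≤ 2 ^ (0.6 : ℝ) := by
    refine le_of_pow_le_pow_left₀ (n := 5) (by norm_num) (by positivity) ?_
    rw [← Real.rpow_mul_natCast (by norm_num)]
    norm_num
  have h4 : (3 / 2 : ℝ) ^ n ≤ 2 ^ (0.6 * (n : ℝ)) := by
    rw [Real.rpow_mul_natCast (by norm_num)]
    exact pow_le_pow_left₀ (by norm_num) h3 n
  have h5 := h2.trans h4
  rw [Real.rpow_neg (by norm_num), ← div_eq_mul_inv, div_le_iff₀ (by positivity),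
    ← Real.rpow_add (by norm_num)] at h5
  rwa [← add_mul, show (0.6 + 0.2 : ℝ) = 0.8 by norm_num] at h5

/-! ### Parametrizing the affine subspaces -/

/-- The points of the affine subspace through `x₀` spanned by the columns of `A`. -/
def affinePoints {n : ℕ} (x₀ : Cube n) (A : Matrix (Fin n) (Fin n) (ZMod 2)) : Finset (Cube n) :=
  Finset.univ.image fun y => x₀ + A.mulVec y

-- The matrix is that of a linear projection onto the direction of `S`. Only the resulting count, at
-- most `2^(n + n²)` nonempty affine subspaces, matters for the union bound.
open Classical in
theorem exists_affinePoints_eq {n : ℕ} {S : AffineSubspace (ZMod 2) (Cube n)} {x₀ : Cube n}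
    (hx₀ : x₀ ∈ S) :
    ∃ A, affinePoints x₀ A = Finset.univ.filter fun x => x ∈ S := by
  obtain ⟨g, hg⟩ := LinearMap.exists_leftInverse_of_injective S.direction.subtype
    (by simp)
  refine ⟨LinearMap.toMatrix' (S.direction.subtype ∘ₗ g), ?_⟩
  ext x
  simp only [affinePoints, Finset.mem_image, Finset.mem_univ, true_and, Finset.mem_filter,
    LinearMap.toMatrix'_mulVec]
  constructor
  · rintro ⟨y, rfl⟩
    have := AffineSubspace.vadd_mem_of_mem_direction (g y).2 hx₀
    rwa [vadd_eq_add, add_comm] at this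
  · intro hx
    have hd := AffineSubspace.vsub_mem_direction hx hx₀
    refine ⟨x - x₀, ?_⟩
    have := LinearMap.congr_fun hg ⟨x - x₀, hd⟩
    simp only [LinearMap.comp_apply, Submodule.subtype_apply, LinearMap.id_apply] at this ⊢
    rw [this]
    simp

/-! ### Tail bounds for the random sparse function -/

/-- The number of points of `s` at which `f` is `1`. -/
def onesIn {n : ℕ} (f : BoolFn n) (s : Finset (Cube n)) : ℕ :=
  (s.filter fun x => f x = true).card

instance {n : ℕ} : MeasureTheory.IsProbabilityMeasure (randomSparse n) := by
  unfold randomSparse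
  infer_instance

theorem measurableSet_boolFn {n : ℕ} (s : Set (BoolFn n)) : MeasurableSet s :=
  s.toFinite.measurableSet

theorem integral_exp_onesIn {n : ℕ} (s : Finset (Cube n)) (l : ℝ) :
    ∫ f, Real.exp (l * onesIn f s) ∂randomSparse n =
      (1 + sparseDensity n * (Real.exp l - 1)) ^ s.card := by
  classical
  let g : Cube n → Bool → ℝ := fun x b => if x ∈ s ∧ b = true then Real.exp l else 1
  have h : ∀ f : BoolFn n, Real.exp (l * onesIn f s) = ∏ x, g x (f x) := by
    intro f
    simp only [g]
    rw [Finset.prod_ite, Finset.prod_const_one, mul_one, Finset.prod_const, ← Real.exp_nat_mul,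
      mul_comm, onesIn]
    congr 4
    ext x
    simp
  rw [MeasureTheory.integral_congr_ae (Eventually.of_forall h), randomSparse]
  refine (MeasureTheory.integral_fintype_prod_eq_prod g).trans ?_
  simp only [g, ProbabilityTheory.integral_bernoulliMeasure]
  rw [← Finset.prod_const, ← Finset.prod_subset (Finset.subset_univ s)]
  · refine Finset.prod_congr rfl fun x hx => ?_
    simp [hx]
    ring
  · intro x _ hx
    simp [hx]

/-- Markov's inequality for the exponential moment. The sign of `l` is free, so both tails are
covered. -/
theorem measure_le_exp {n : ℕ} (s : Finset (Cube n)) (l a : ℝ) :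
    (randomSparse n).real {f | a ≤ l * onesIn f s} ≤
      Real.exp (sparseDensity n * s.card * (Real.exp l - 1) - a) := by
  have hp := (sparseDensity n).2
  have h := MeasureTheory.mul_meas_ge_le_integral_of_nonneg (μ := randomSparse n)
    (f := fun f => Real.exp (l * onesIn f s)) (Eventually.of_forall fun f => (Real.exp_pos _).le)
    (MeasureTheory.Integrable.of_finite) (Real.exp a)
  simp only [Real.exp_le_exp, integral_exp_onesIn] at h
  rw [Real.exp_sub, le_div_iff₀ (Real.exp_pos a), mul_comm]
  refine h.trans ?_
  rw [mul_comm _ (s.card : ℝ), mul_assoc, Real.exp_nat_mul]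
  refine pow_le_pow_left₀ ?_ ?_ _
  · have := Real.exp_pos l
    nlinarith [hp.1, hp.2]
  · rw [add_comm]
    exact Real.add_one_le_exp _

theorem sparseDensity_mul_card_le {n : ℕ} (s : Finset (Cube n)) :
    (sparseDensity n : ℝ) * s.card ≤ 2 ^ (0.1 * (n : ℝ)) := by
  have h : (s.card : ℝ) ≤ 2 ^ (n : ℝ) := by
    rw [Real.rpow_natCast]
    exact_mod_cast (Finset.card_le_univ s).trans_eq (by simp [ZMod.card])
  calc (sparseDensity n : ℝ) * s.card ≤ 2 ^ (-(0.9 * (n : ℝ))) * 2 ^ (n : ℝ) :=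
        mul_le_mul_of_nonneg_left h (sparseDensity n).2.1
    _ = 2 ^ (0.1 * (n : ℝ)) := by
        rw [← Real.rpow_add (by norm_num)]
        ring_nf

theorem measure_deviation_le {n : ℕ} (s : Finset (Cube n)) :
    (randomSparse n).real {f | 2 ^ (0.08 * (n : ℝ)) <
        |(onesIn f s : ℝ) - sparseDensity n * s.card|} ≤
      2 * Real.exp (-(2 ^ (0.06 * (n : ℝ)) / 4)) := by
  have hM := sparseDensity_mul_card_le s
  set m : ℝ := sparseDensity n * s.card with hm
  have hm0 : 0 ≤ m := mul_nonneg (sparseDensity n).2.1 (Nat.cast_nonneg _)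
  -- This `l` maximizes `lτ - l² 2^(0.1n)`, where `2^(0.1n)` bounds the mean; the maximum is
  -- `2^(0.06n)/4`.
  set l : ℝ := 2 ^ (-(0.02 * (n : ℝ))) / 2 with hl
  set τ : ℝ := 2 ^ (0.08 * (n : ℝ)) with hτ
  have hl0 : 0 < l := by positivity
  have hl1 : l ≤ 1 := by
    have : (2 : ℝ) ^ (-(0.02 * (n : ℝ))) ≤ 1 :=
      Real.rpow_le_one_of_one_le_of_nonpos (by norm_num) (by
        have : (0 : ℝ) ≤ n := n.cast_nonneg
        linarith)
    linarith
  have e1 : (2 : ℝ) ^ (0.1 * (n : ℝ)) * l ^ 2 = 2 ^ (0.06 * (n : ℝ)) / 4 := by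
    rw [hl, div_pow, ← Real.rpow_mul_natCast (by norm_num), ← mul_div_assoc,
      ← Real.rpow_add (by norm_num)]
    norm_num
    ring_nf
  have e2 : l * τ = 2 ^ (0.06 * (n : ℝ)) / 2 := by
    rw [hl, hτ, div_mul_eq_mul_div, ← Real.rpow_add (by norm_num)]
    ring_nf
  have key : ∀ k : ℝ, |k| = l → (randomSparse n).real {f | k * m + l * τ ≤ k * onesIn f s} ≤
      Real.exp (-(2 ^ (0.06 * (n : ℝ)) / 4)) := by
    intro k hk
    refine (measure_le_exp s k _).trans (Real.exp_le_exp.2 ?_)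
    have h1 := (abs_le.1 (Real.abs_exp_sub_one_sub_id_le (hk.trans_le hl1))).2
    have h2 : k ^ 2 = l ^ 2 := by rw [← hk, sq_abs]
    have h3 : m * (Real.exp k - 1 - k) ≤ 2 ^ (0.1 * (n : ℝ)) * l ^ 2 :=
      mul_le_mul hM (h1.trans_eq h2)
        (by linarith [Real.add_one_le_exp k]) (by positivity)
    rw [← hm]
    linarith
  calc _ ≤ (randomSparse n).real ({f | l * m + l * τ ≤ l * onesIn f s} ∪
        {f | -l * m + l * τ ≤ -l * onesIn f s}) := by
        refine MeasureTheory.measureReal_mono fun f hf => ?_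
        simp only [Set.mem_ofPred_eq, Set.mem_union, lt_abs] at hf ⊢
        rcases hf with hf | hf
        · left; nlinarith
        · right; nlinarith
    _ ≤ _ := (MeasureTheory.measureReal_union_le _ _).trans (by
        rw [two_mul]
        exact add_le_add (key l (abs_of_pos hl0)) (key (-l) (by rw [abs_neg, abs_of_pos hl0])))

theorem measure_hammingBall_le {n : ℕ} (c : Cube n) :
    (randomSparse n).real {f | 20 ≤ onesIn f (hammingBall c)} ≤
      Real.exp 1 * 2 ^ (-(2 * (n : ℝ))) := by
  -- The mean is at most `2^(-0.1n)`, so `e^l = 2^(0.1n)` keeps the moment term at most 1, while 20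
  -- ones cost `e^(-20l) = 2^(-2n)`, enough to beat the `2^n` centres.
  set l : ℝ := Real.log 2 * (0.1 * n) with hl
  have hl0 : 0 ≤ l := mul_nonneg (Real.log_nonneg (by norm_num)) (by positivity)
  have hexp : Real.exp l = 2 ^ (0.1 * (n : ℝ)) := (Real.rpow_def_of_pos (by norm_num) _).symm
  calc _ ≤ (randomSparse n).real {f | l * 20 ≤ l * onesIn f (hammingBall c)} := by
        refine MeasureTheory.measureReal_mono fun f hf => ?_
        have : (20 : ℝ) ≤ onesIn f (hammingBall c) := by exact_mod_cast hf
        exact mul_le_mul_of_nonneg_left this hl0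
    _ ≤ _ := measure_le_exp _ _ _
    _ ≤ Real.exp (1 - l * 20) := by
        refine Real.exp_le_exp.2 (sub_le_sub_right ?_ _)
        rw [hexp]
        have h1 : (sparseDensity n : ℝ) * (hammingBall c).card ≤
            2 ^ (-(0.9 * (n : ℝ))) * 2 ^ (0.8 * (n : ℝ)) :=
          mul_le_mul_of_nonneg_left (card_hammingBall_le c) (sparseDensity n).2.1
        have h2 : (2 : ℝ) ^ (-(0.9 * (n : ℝ))) * 2 ^ (0.8 * (n : ℝ)) * 2 ^ (0.1 * (n : ℝ)) = 1 := by
          rw [← Real.rpow_add (by norm_num), ← Real.rpow_add (by norm_num)]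
          ring_nf
          simp
        have h3 : (1 : ℝ) ≤ 2 ^ (0.1 * (n : ℝ)) :=
          Real.one_le_rpow (by norm_num) (by positivity)
        rw [← h2]
        exact mul_le_mul h1 (by linarith) (by linarith) (by positivity)
    _ = _ := by
        rw [Real.exp_sub, Real.rpow_neg (by norm_num), div_eq_mul_inv,
          Real.rpow_def_of_pos (by norm_num : (0 : ℝ) < 2), hl]
        ring_nf

/-! ### Typical functions -/

open Classical in
/-- `f` has about the expected number of ones in every affine subspace, and few ones in every
Hamming ball of radius `n / 5`. -/
structure IsTypical {n : ℕ} (f : BoolFn n) : Prop where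
  affine : ∀ S : AffineSubspace (ZMod 2) (Cube n),
    |(onesIn f (Finset.univ.filter fun x => x ∈ S) : ℝ) -
      sparseDensity n * (Finset.univ.filter fun x => x ∈ S).card| ≤ 2 ^ (0.08 * (n : ℝ))
  ball : ∀ c, onesIn f (hammingBall c) < 20

theorem measure_not_isTypical_le (n : ℕ) :
    (randomSparse n).real {f | ¬ IsTypical f} ≤
      2 ^ (n + n * n) * (2 * Real.exp (-(2 ^ (0.06 * (n : ℝ)) / 4))) +
        2 ^ n * (Real.exp 1 * 2 ^ (-(2 * (n : ℝ)))) := by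
  classical
  let A : Cube n × Matrix (Fin n) (Fin n) (ZMod 2) → Set (BoolFn n) := fun b =>
    {f | 2 ^ (0.08 * (n : ℝ)) < |(onesIn f (affinePoints b.1 b.2) : ℝ) -
      sparseDensity n * (affinePoints b.1 b.2).card|}
  let B : Cube n → Set (BoolFn n) := fun c => {f | 20 ≤ onesIn f (hammingBall c)}
  have hsub : {f : BoolFn n | ¬ IsTypical f} ⊆ (⋃ b, A b) ∪ ⋃ c, B c := by
    intro f hf
    by_contra h
    simp only [Set.mem_union, Set.mem_iUnion, not_or, not_exists] at h
    refine hf ⟨fun S => ?_, fun c => not_le.1 (h.2 c)⟩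
    -- The empty affine subspace has no base point and is outside the parametrization.
    rcases (S : Set (Cube n)).eq_empty_or_nonempty with hS | ⟨x₀, hx₀⟩
    · have : (Finset.univ.filter fun x => x ∈ S) = ∅ := by
        refine Finset.filter_eq_empty_iff.2 fun x _ hx => ?_
        have hx' : x ∈ (S : Set (Cube n)) := hx
        rw [hS] at hx'
        exact hx'
      rw [this]
      simp only [onesIn, Finset.filter_empty, Finset.card_empty, Nat.cast_zero, mul_zero, sub_zero,
        abs_zero]
      positivity
    · obtain ⟨M, hM⟩ := exists_affinePoints_eq (S := S) hx₀
      rw [← hM]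
      exact not_lt.1 (h.1 (x₀, M))
  refine (MeasureTheory.measureReal_mono hsub).trans
    ((MeasureTheory.measureReal_union_le _ _).trans (add_le_add ?_ ?_))
  · refine (MeasureTheory.measureReal_iUnion_fintype_le A).trans ?_
    refine (Finset.sum_le_sum fun b _ => measure_deviation_le (affinePoints b.1 b.2)).trans_eq ?_
    rw [Finset.sum_const, nsmul_eq_mul, Finset.card_univ, Fintype.card_prod]
    have : Fintype.card (Matrix (Fin n) (Fin n) (ZMod 2)) = 2 ^ (n * n) := by
      rw [Fintype.card_congr Matrix.of.symm]
      simp [ZMod.card, pow_mul]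
    rw [this]
    simp [ZMod.card, pow_add]
  · refine (MeasureTheory.measureReal_iUnion_fintype_le B).trans ?_
    refine (Finset.sum_le_sum fun c _ => measure_hammingBall_le c).trans_eq ?_
    simp [ZMod.card]

theorem eventually_const_mul_sq_le (a : ℝ) {r : ℝ} (hr : 0 < r) :
    ∀ᶠ n : ℕ in atTop, a * (n : ℝ) ^ 2 ≤ 2 ^ (r * (n : ℝ)) := by
  have h := tendsto_pow_const_div_const_pow_of_one_lt 2
    (Real.one_lt_rpow (by norm_num : (1 : ℝ) < 2) hr)
  filter_upwards [h.eventually (ge_mem_nhds (by positivity : (0 : ℝ) < 1 / (|a| + 1)))] with n hn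
  rw [Real.rpow_mul_natCast (by norm_num)]
  rw [div_le_div_iff₀ (by positivity) (by positivity)] at hn
  nlinarith [le_abs_self a, sq_nonneg (n : ℝ)]

theorem eventually_measure_not_isTypical_le :
    ∀ᶠ n : ℕ in atTop,
      (randomSparse n).real {f | ¬ IsTypical f} ≤ 2 ^ (-(1 / 2 * (n : ℝ))) := by
  -- The constant 20 gives `2^(0.06n)/4 ≥ 5n²`, which dominates the exponent `n² + 2n + 1` needed to
  -- absorb the union bound and leave `2^(-n)`.
  filter_upwards [eventually_const_mul_sq_le 20 (r := 0.06) (by norm_num),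
    eventually_ge_atTop 6] with n hn hn6
  have hn6' : (6 : ℝ) ≤ n := by exact_mod_cast hn6
  refine (measure_not_isTypical_le n).trans ?_
  have hlog := Real.log_two_lt_d9
  have hlog0 := Real.log_two_gt_d9
  have hpow : ∀ k : ℕ, (2 : ℝ) ^ k = Real.exp (k * Real.log 2) := fun k => by
    rw [Real.exp_nat_mul, Real.exp_log (by norm_num)]
  have h1 : (2 : ℝ) ^ (n + n * n) * (2 * Real.exp (-(2 ^ (0.06 * (n : ℝ)) / 4))) ≤
      2 ^ (-(n : ℝ)) := by
    rw [← mul_assoc, ← pow_succ, hpow, ← Real.exp_add,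
      Real.rpow_def_of_pos (by norm_num) (-(n : ℝ))]
    refine Real.exp_le_exp.2 ?_
    push_cast
    have : ((n : ℝ) + n * n + 1 + n) * Real.log 2 ≤ ((n : ℝ) + n * n + 1 + n) * 1 :=
      mul_le_mul_of_nonneg_left (by linarith) (by positivity)
    nlinarith
  have h2 : (2 : ℝ) ^ n * (Real.exp 1 * 2 ^ (-(2 * (n : ℝ)))) = Real.exp 1 * 2 ^ (-(n : ℝ)) := by
    rw [mul_left_comm, ← Real.rpow_natCast, ← Real.rpow_add (by norm_num)]
    ring_nf
  have h3 : (2 : ℝ) ^ (-(n : ℝ)) = 2 ^ (-(1 / 2 * (n : ℝ))) * 2 ^ (-(1 / 2 * (n : ℝ))) := by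
    rw [← Real.rpow_add (by norm_num)]
    ring_nf
  have h4 : (2 : ℝ) ^ (-(1 / 2 * (n : ℝ))) ≤ 2 ^ (-3 : ℝ) :=
    Real.rpow_le_rpow_of_exponent_le (by norm_num) (by linarith)
  have h5 : (2 : ℝ) ^ (-3 : ℝ) = 1 / 8 := by
    rw [Real.rpow_neg (by norm_num)]; norm_num
  have h6 := Real.exp_one_lt_d9
  have h7 : (0 : ℝ) < 2 ^ (-(1 / 2 * (n : ℝ))) := by positivity
  rw [h2]
  refine (add_le_add_left h1 _).trans ?_
  rw [h3]
  nlinarith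


/-! ### Typical functions have large discrepancy -/

theorem sparseDensity_mul_two_pow (n : ℕ) :
    (sparseDensity n : ℝ) * 2 ^ n = 2 ^ (0.1 * (n : ℝ)) := by
  change (2 : ℝ) ^ (-(0.9 * (n : ℝ))) * 2 ^ n = _
  rw [← Real.rpow_natCast 2 n, ← Real.rpow_add (by norm_num)]
  ring_nf

theorem IsTypical.abs_onesIn_univ_sub_le {n : ℕ} {f : BoolFn n} (hf : IsTypical f) :
    |(onesIn f Finset.univ : ℝ) - 2 ^ (0.1 * (n : ℝ))| ≤ 2 ^ (0.08 * (n : ℝ)) := by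
  have h := hf.affine ⊤
  simpa [ZMod.card, sparseDensity_mul_two_pow] using h

theorem two_rpow_le_half {n : ℕ} (hn : 50 ≤ n) :
    (2 : ℝ) ^ (0.08 * (n : ℝ)) ≤ 2 ^ (0.1 * (n : ℝ)) / 2 := by
  have hn' : (50 : ℝ) ≤ n := by exact_mod_cast hn
  rw [le_div_iff₀ (by norm_num), ← Real.rpow_add_one (by norm_num)]
  exact Real.rpow_le_rpow_of_exponent_le (by norm_num) (by linarith)

theorem IsTypical.onesIn_univ_bounds {n : ℕ} {f : BoolFn n} (hf : IsTypical f) (hn : 50 ≤ n) :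
    2 ^ (0.1 * (n : ℝ)) / 2 ≤ (onesIn f Finset.univ : ℝ) ∧
      (onesIn f Finset.univ : ℝ) ≤ 2 * 2 ^ (0.1 * (n : ℝ)) := by
  have h := abs_le.1 hf.abs_onesIn_univ_sub_le
  have h1 := two_rpow_le_half hn
  have h2 : (0 : ℝ) < 2 ^ (0.1 * (n : ℝ)) := by positivity
  constructor <;> linarith

theorem sum_ite_eq_onesIn {n : ℕ} (f : BoolFn n) (s : Finset (Cube n)) (a b : ℝ) :
    ∑ x ∈ s, (if f x then a else b) = onesIn f s * a + (s.card - onesIn f s) * b := by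
  have h := Finset.card_filter_add_card_filter_not (s := s) (fun x => f x = true)
  have h' : (s.card : ℝ) =
      onesIn f s + (s.filter fun x => ¬ f x = true).card := by
    rw [← h]
    push_cast
    rfl
  rw [Finset.sum_ite, Finset.sum_const, Finset.sum_const, nsmul_eq_mul, nsmul_eq_mul, h',
    add_sub_cancel_left]
  rfl

/-- Half of the mass spread evenly over `f⁻¹(1)`, half over `f⁻¹(0)`. -/
def balancedDist {n : ℕ} (f : BoolFn n) (h0 : 0 < (onesIn f Finset.univ : ℝ))
    (h1 : (onesIn f Finset.univ : ℝ) < 2 ^ n) : Dist n :=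
  ⟨fun x => if f x then (2 * (onesIn f Finset.univ : ℝ))⁻¹
      else (2 * (2 ^ n - (onesIn f Finset.univ : ℝ)))⁻¹, by
    have h2 : 0 < (2 : ℝ) ^ n - onesIn f Finset.univ := sub_pos.2 h1
    constructor
    · intro x
      dsimp only
      split_ifs <;> positivity
    · rw [sum_ite_eq_onesIn]
      have : ((Finset.univ : Finset (Cube n)).card : ℝ) = 2 ^ n := by simp [ZMod.card]
      rw [this]
      field_simp
      norm_num⟩

theorem IsTypical.bias_balancedDist_le {n : ℕ} {f : BoolFn n} (hf : IsTypical f) (hn : 50 ≤ n)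
    (h0 : 0 < (onesIn f Finset.univ : ℝ)) (h1 : (onesIn f Finset.univ : ℝ) < 2 ^ n)
    (S : AffineSubspace (ZMod 2) (Cube n)) :
    bias f (balancedDist f h0 h1) S ≤ 2 ^ (2 - 0.02 * (n : ℝ)) := by
  classical
  obtain ⟨hX1, hX2⟩ := hf.onesIn_univ_bounds hn
  have hn' : (50 : ℝ) ≤ n := by exact_mod_cast hn
  have hS := hf.affine S
  have hT := hf.abs_onesIn_univ_sub_le
  rw [← sparseDensity_mul_two_pow] at hT
  have hV : ((Finset.univ.filter fun x => x ∈ S).card : ℝ) ≤ 2 ^ n := by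
    exact_mod_cast (Finset.card_le_univ _).trans_eq (by simp [ZMod.card])
  have hN : 2 * (2 * (2 : ℝ) ^ (0.1 * (n : ℝ))) ≤ 2 ^ n := by
    rw [← mul_assoc, show (2 * 2 : ℝ) = 2 ^ (2 : ℝ) by norm_num, ← Real.rpow_add (by norm_num),
      ← Real.rpow_natCast 2 n]
    exact Real.rpow_le_rpow_of_exponent_le (by norm_num) (by linarith)
  have e : bias f (balancedDist f h0 h1) S =
      |∑ x ∈ Finset.univ.filter fun x => x ∈ S,
        if f x then -(2 * (onesIn f Finset.univ : ℝ))⁻¹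
          else (2 * (2 ^ n - (onesIn f Finset.univ : ℝ)))⁻¹| := by
    unfold bias
    rw [Finset.sum_filter]
    congr 1
    refine Finset.sum_congr rfl fun x _ => ?_
    by_cases hx : f x <;> simp [balancedDist, hx]
  rw [e, sum_ite_eq_onesIn]
  clear e
  have hexp : (2 : ℝ) ^ (2 - 0.02 * (n : ℝ)) * 2 ^ (0.1 * (n : ℝ)) = 4 * 2 ^ (0.08 * (n : ℝ)) := by
    rw [show (4 : ℝ) = 2 ^ (2 : ℝ) by norm_num, ← Real.rpow_add (by norm_num),
      ← Real.rpow_add (by norm_num)]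
    ring_nf
  have hE0 : (0 : ℝ) < 2 ^ (2 - 0.02 * (n : ℝ)) := by positivity
  have hτ0 : (0 : ℝ) < 2 ^ (0.08 * (n : ℝ)) := by positivity
  have hN0 : (0 : ℝ) < 2 ^ n := by positivity
  generalize (2 : ℝ) ^ (2 - 0.02 * (n : ℝ)) = E at *
  generalize (2 : ℝ) ^ (0.08 * (n : ℝ)) = τ at *
  generalize (2 : ℝ) ^ (0.1 * (n : ℝ)) = M at *
  generalize (2 : ℝ) ^ n = N at *
  generalize (onesIn f Finset.univ : ℝ) = X at *
  generalize (onesIn f (Finset.univ.filter fun x => x ∈ S) : ℝ) = Y at *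
  have hV0 : 0 ≤ ((Finset.univ.filter fun x => x ∈ S).card : ℝ) := Nat.cast_nonneg _
  generalize ((Finset.univ.filter fun x => x ∈ S).card : ℝ) = V at *
  generalize (sparseDensity n : ℝ) = p at *
  have hNX : 0 < N - X := by linarith
  -- The numerator is `VX - NY`; inserting `pNV` expresses it through the two deviations that
  -- typicality controls.
  have e2 : Y * -(2 * X)⁻¹ + (V - Y) * (2 * (N - X))⁻¹ =
      (V * (X - p * N) - N * (Y - p * V)) / (2 * X * (N - X)) := by
    field_simp
    ring
  rw [e2, abs_div, abs_of_pos (by positivity : 0 < 2 * X * (N - X)), div_le_iff₀ (by positivity)]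
  calc |V * (X - p * N) - N * (Y - p * V)| ≤ |V * (X - p * N)| + |N * (Y - p * V)| := abs_sub _ _
    _ = V * |X - p * N| + N * |Y - p * V| := by
        rw [abs_mul, abs_mul, abs_of_nonneg hV0, abs_of_pos hN0]
    _ ≤ N * τ + N * τ := add_le_add (mul_le_mul hV hT (abs_nonneg _) hN0.le)
        (mul_le_mul_of_nonneg_left hS hN0.le)
    _ = E * (2 * (M / 2) * (N / 2)) := by linear_combination (-N / 2) * hexp
    _ ≤ E * (2 * X * (N - X)) := by
        refine mul_le_mul_of_nonneg_left ?_ hE0.le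
        exact mul_le_mul (by linarith) (by linarith) (by linarith) (by linarith)

theorem IsTypical.le_disc {n : ℕ} {f : BoolFn n} (hf : IsTypical f) (hn : 200 ≤ n) :
    0.01 * (n : ℝ) ≤ disc f := by
  obtain ⟨hX1, hX2⟩ := hf.onesIn_univ_bounds (by omega)
  have hn' : (200 : ℝ) ≤ n := by exact_mod_cast hn
  have h0 : 0 < (onesIn f Finset.univ : ℝ) := lt_of_lt_of_le (by positivity) hX1
  have h1 : (onesIn f Finset.univ : ℝ) < 2 ^ n := by
    refine hX2.trans_lt ?_
    rw [mul_comm, ← Real.rpow_add_one (by norm_num), ← Real.rpow_natCast 2 n]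
    exact Real.rpow_lt_rpow_of_exponent_lt (by norm_num) (by linarith)
  have h2 := le_discOn_of_bias_le (hf.bias_balancedDist_le (by omega) h0 h1)
  rw [Real.logb_rpow (by norm_num) (by norm_num)] at h2
  have h3 : discOn f (balancedDist f h0 h1) ≤ disc f := le_ciSup (bddAbove_discOn f) _
  linarith

/-! ### Recognizing a small set by few parities -/

theorem exists_tree_of_parities {n : ℕ} : ∀ (k : ℕ) (a : Fin k → Cube n)
    (g : (Fin k → ZMod 2) → Bool),
    ∃ T : ParityTree n, T.depth ≤ k ∧ ∀ x, T.eval x = g fun i => a i ⬝ᵥ x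
  | 0, _, g => ⟨.leaf (g Fin.elim0), le_rfl, fun _ => congrArg g (funext fun i => i.elim0)⟩
  | k + 1, a, g => by
    obtain ⟨T₀, d₀, e₀⟩ := exists_tree_of_parities k (Fin.tail a) fun y => g (Fin.cons 0 y)
    obtain ⟨T₁, d₁, e₁⟩ := exists_tree_of_parities k (Fin.tail a) fun y => g (Fin.cons 1 y)
    refine ⟨.query (a 0) T₀ T₁, ?_, fun x => ?_⟩
    · simp only [ParityTree.depth]
      omega
    · have h : (fun i => a i ⬝ᵥ x) = Fin.cons (a 0 ⬝ᵥ x) fun i => Fin.tail a i ⬝ᵥ x := by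
        funext i
        refine Fin.cases ?_ (fun j => ?_) i <;> simp [Fin.tail]
      rw [h]
      simp only [ParityTree.eval, e₀, e₁]
      rcases zmod_two_eq (a 0 ⬝ᵥ x) with h | h <;> simp [h]

/-- Flipping `b` at a coordinate where `x` and `z` differ exchanges the parities that separate them
with those that do not. -/
theorem two_mul_card_dotProduct_eq {n : ℕ} {x z : Cube n} (hxz : x ≠ z) :
    2 * (Finset.univ.filter fun b : Cube n => b ⬝ᵥ x = b ⬝ᵥ z).card = 2 ^ n := by
  obtain ⟨i, hi⟩ := Function.ne_iff.1 hxz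
  have h := Finset.card_filter_add_card_filter_not (s := (Finset.univ : Finset (Cube n)))
    (fun b => b ⬝ᵥ x = b ⬝ᵥ z)
  have hflip : ∀ b : Cube n, (b + Pi.single i 1) ⬝ᵥ x = (b + Pi.single i 1) ⬝ᵥ z ↔
      ¬ b ⬝ᵥ x = b ⬝ᵥ z := by
    intro b
    simp only [add_dotProduct, single_one_dotProduct]
    generalize b ⬝ᵥ x = u
    generalize b ⬝ᵥ z = v
    generalize x i = r at *
    generalize z i = s at *
    revert u v r s
    decide
  have h2 : (Finset.univ.filter fun b : Cube n => ¬ b ⬝ᵥ x = b ⬝ᵥ z).card =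
      (Finset.univ.filter fun b : Cube n => b ⬝ᵥ x = b ⬝ᵥ z).card := by
    refine Finset.card_nbij' (fun b => b + Pi.single i 1) (fun b => b + Pi.single i 1) ?_ ?_ ?_ ?_
    · intro b hb
      simp only [Finset.coe_filter, Finset.mem_univ, true_and, Set.mem_ofPred_eq, hflip] at hb ⊢
      exact hb
    · intro b hb
      simp only [Finset.coe_filter, Finset.mem_univ, true_and, Set.mem_ofPred_eq, hflip,
        not_not] at hb ⊢
      exact hb
    · exact fun b _ => cube_add_cancel b _
    · exact fun b _ => cube_add_cancel b _
  rw [h2, Finset.card_univ] at h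
  rw [two_mul, h]
  simp [ZMod.card]

theorem card_parities_agree {n k : ℕ} {x z : Cube n} (hxz : x ≠ z) :
    ((Finset.univ.filter fun a : Fin k → Cube n => ∀ i, a i ⬝ᵥ x = a i ⬝ᵥ z).card : ℝ) =
      (2 ^ n) ^ k / 2 ^ k := by
  classical
  have h1 : (Finset.univ.filter fun a : Fin k → Cube n => ∀ i, a i ⬝ᵥ x = a i ⬝ᵥ z) =
      Fintype.piFinset fun _ => Finset.univ.filter fun b : Cube n => b ⬝ᵥ x = b ⬝ᵥ z := by
    ext a
    simp
  have h2 : (2 : ℝ) * (Finset.univ.filter fun b : Cube n => b ⬝ᵥ x = b ⬝ᵥ z).card = 2 ^ n := by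
    exact_mod_cast two_mul_card_dotProduct_eq hxz
  rw [h1, Fintype.card_piFinset_const, ← h2]
  push_cast
  rw [mul_pow, mul_div_cancel_left₀ _ (by positivity)]

-- Query `k` random parities and accept when the answers match those of some point of `Z`. Points of
-- `Z` are always accepted; any other point matches a given `z` with probability `2^(-k)`. Averaging
-- over the parities yields one good choice.
open Classical in
theorem exists_tree_err_indicator_le {n : ℕ} (Z : Finset (Cube n)) (μ : Dist n) (k : ℕ) :
    ∃ T : ParityTree n, T.depth ≤ k ∧
      T.err (fun x => decide (x ∈ Z)) μ ≤ Z.card / 2 ^ k := by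
  have hT := fun a : Fin k → Cube n => exists_tree_of_parities k a
    fun y => decide (∃ z ∈ Z, ∀ i, y i = a i ⬝ᵥ z)
  choose T hd he using hT
  suffices h : ∑ a, (T a).err (fun x => decide (x ∈ Z)) μ ≤
      ∑ _a : Fin k → Cube n, (Z.card : ℝ) / 2 ^ k by
    obtain ⟨a, -, ha⟩ := Finset.exists_le_of_sum_le Finset.univ_nonempty h
    exact ⟨T a, hd a, ha⟩
  have hpt : ∀ a x, (if (T a).eval x ≠ decide (x ∈ Z) then μ.1 x else 0) ≤
      ∑ z ∈ Z, if x ≠ z ∧ ∀ i, a i ⬝ᵥ x = a i ⬝ᵥ z then μ.1 x else 0 := by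
    intro a x
    have hμ := μ.2.1 x
    have hnn : ∀ z ∈ Z, 0 ≤ if x ≠ z ∧ ∀ i, a i ⬝ᵥ x = a i ⬝ᵥ z then μ.1 x else 0 :=
      fun z _ => by split_ifs <;> simp [hμ]
    rw [he]
    split_ifs with h
    · by_cases hx : x ∈ Z
      · exact absurd (by simpa [hx] using ⟨x, hx, fun _ => rfl⟩) h
      · simp only [hx, decide_false, ne_eq, decide_eq_false_iff_not, not_not] at h
        obtain ⟨z, hz, hzx⟩ := h
        refine le_trans ?_ (Finset.single_le_sum hnn hz)
        rw [if_pos ⟨fun h => hx (h ▸ hz), hzx⟩]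
    · exact Finset.sum_nonneg hnn
  calc ∑ a, (T a).err (fun x => decide (x ∈ Z)) μ
      ≤ ∑ a : Fin k → Cube n, ∑ x, ∑ z ∈ Z,
          if x ≠ z ∧ ∀ i, a i ⬝ᵥ x = a i ⬝ᵥ z then μ.1 x else 0 :=
        Finset.sum_le_sum fun a _ => Finset.sum_le_sum fun x _ => hpt a x
    _ = ∑ x, ∑ z ∈ Z, ∑ a : Fin k → Cube n,
          if x ≠ z ∧ ∀ i, a i ⬝ᵥ x = a i ⬝ᵥ z then μ.1 x else 0 := by
        rw [Finset.sum_comm]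
        exact Finset.sum_congr rfl fun x _ => Finset.sum_comm
    _ ≤ ∑ x, ∑ z ∈ Z, (2 ^ n) ^ k / 2 ^ k * μ.1 x := by
        refine Finset.sum_le_sum fun x _ => Finset.sum_le_sum fun z _ => ?_
        have hμ := μ.2.1 x
        by_cases hxz : x = z
        · simp only [hxz, ne_eq, not_true_eq_false, false_and, if_false, Finset.sum_const_zero]
          rw [← hxz]
          positivity
        · simp only [ne_eq, hxz, not_false_eq_true, true_and]
          rw [← Finset.sum_filter, Finset.sum_const, nsmul_eq_mul, card_parities_agree hxz]
    _ = _ := by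
        simp only [Finset.sum_const, nsmul_eq_mul, ← Finset.mul_sum, μ.2.2, Finset.card_univ]
        simp [ZMod.card]
        ring

/-! ### Typical functions are easy under product distributions -/

/-- The most likely point under a product distribution. -/
def mode {n : ℕ} (p : Fin n → unitInterval) : Cube n :=
  fun i => if (p i : ℝ) ≤ 1 / 2 then 0 else 1

theorem productDist_eq {n : ℕ} (p : Fin n → unitInterval) (x : Cube n) :
    (productDist p).1 x = ∏ i, if x i = mode p i then 1 - min (p i : ℝ) (1 - p i)
      else min (p i : ℝ) (1 - p i) := by
  change ∏ i, (if x i = 1 then (p i : ℝ) else 1 - p i) = _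
  refine Finset.prod_congr rfl fun i _ => ?_
  by_cases h : (p i : ℝ) ≤ 1 / 2
  · rw [min_eq_left (by linarith)]
    rcases zmod_two_eq (x i) with hx | hx <;> simp only [mode, hx, h, if_true] <;> simp
  · rw [min_eq_right (by linarith)]
    rcases zmod_two_eq (x i) with hx | hx <;> simp only [mode, hx, h, if_false] <;> simp

theorem productDist_le_exp {n : ℕ} (p : Fin n → unitInterval) (x : Cube n) :
    (productDist p).1 x ≤ Real.exp (-∑ i, min (p i : ℝ) (1 - p i)) := by
  rw [productDist_eq, ← Finset.sum_neg_distrib, Real.exp_sum]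
  refine Finset.prod_le_prod (fun i _ => ?_) fun i _ => ?_
  all_goals
    have h0 := (p i).2.1
    have h1 := (p i).2.2
    have h2 := Real.add_one_le_exp (-min (p i : ℝ) (1 - p i))
    have h3 := min_le_left (p i : ℝ) (1 - p i)
    have h4 := min_le_right (p i : ℝ) (1 - p i)
    have h5 : 0 ≤ min (p i : ℝ) (1 - p i) := le_min h0 (by linarith)
    split_ifs <;> linarith

/-- With `qᵢ = min(pᵢ, 1 - pᵢ)` the probability of leaving the mode at `i`, the moment factors as `∏
(1 + qᵢ)`. Markov's inequality then bounds the mass far from the mode. -/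
theorem sum_productDist_mul_two_pow_le {n : ℕ} (p : Fin n → unitInterval) :
    ∑ x, (productDist p).1 x * 2 ^ hammingDist x (mode p) ≤
      Real.exp (∑ i, min (p i : ℝ) (1 - p i)) := by
  let g : Fin n → ZMod 2 → ℝ := fun i b =>
    if b = mode p i then 1 - min (p i : ℝ) (1 - p i) else min (p i : ℝ) (1 - p i) * 2
  have h : ∀ x, (productDist p).1 x * 2 ^ hammingDist x (mode p) = ∏ i, g i (x i) := by
    intro x
    rw [productDist_eq, ← prod_ite_eq_pow_hammingDist, ← Finset.prod_mul_distrib]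
    refine Finset.prod_congr rfl fun i _ => ?_
    simp only [g]
    split_ifs <;> simp
  rw [Finset.sum_congr rfl fun x _ => h x, sum_prod_cube g, Real.exp_sum]
  have hi : ∀ i, g i 0 + g i 1 = min (p i : ℝ) (1 - p i) + 1 := by
    intro i
    rcases zmod_two_eq (mode p i) with h | h <;> simp [g, h] <;> ring
  refine Finset.prod_le_prod (fun i _ => ?_) fun i _ => ?_
  · rw [hi]
    have : 0 ≤ min (p i : ℝ) (1 - p i) := le_min (p i).2.1 (by linarith [(p i).2.2])
    linarith
  · rw [hi]
    exact Real.add_one_le_exp _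

theorem sum_productDist_notMem_ball_le {n : ℕ} (p : Fin n → unitInterval) :
    ∑ x ∈ (hammingBall (mode p))ᶜ, (productDist p).1 x ≤
      Real.exp (∑ i, min (p i : ℝ) (1 - p i)) * 2 ^ (-(0.2 * (n : ℝ))) := by
  have h0 := (productDist p).2.1
  rw [Real.rpow_neg (by norm_num), ← div_eq_mul_inv, le_div_iff₀ (by positivity), Finset.sum_mul]
  refine le_trans ?_ (sum_productDist_mul_two_pow_le p)
  refine (Finset.sum_le_sum fun x hx => ?_).trans (Finset.sum_le_sum_of_subset_of_nonneg
    (Finset.subset_univ (hammingBall (mode p))ᶜ) fun x _ _ => mul_nonneg (h0 x) (by positivity))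
  refine mul_le_mul_of_nonneg_left ?_ (h0 x)
  have hx' : n < 5 * hammingDist x (mode p) := by simpa [hammingBall] using hx
  have hx2 : (n : ℝ) < 5 * hammingDist x (mode p) := by exact_mod_cast hx'
  rw [← Real.rpow_natCast]
  exact Real.rpow_le_rpow_of_exponent_le (by norm_num) (by linarith)

theorem IsTypical.distComplexity_le {n : ℕ} {f : BoolFn n} (hf : IsTypical f) (hn : 1000 ≤ n)
    (p : Fin n → unitInterval) : distComplexity (1 / 3) f (productDist p) ≤ 6 := by
  classical
  have hn' : (1000 : ℝ) ≤ n := by exact_mod_cast hn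
  suffices h : ∃ T : ParityTree n, T.depth ≤ 6 ∧ T.err f (productDist p) ≤ 1 / 3 by
    obtain ⟨T, hd, he⟩ := h
    unfold distComplexity
    exact le_trans (Nat.sInf_le ⟨T, rfl, he⟩) hd
  have h0 := (productDist p).2.1
  have hlog := Real.log_two_lt_d9
  have hlog0 := Real.log_two_gt_d9
  have hsmall : ∀ r : ℝ, r ≤ -8 → (2 : ℝ) ^ r ≤ 1 / 256 := by
    intro r hr
    refine (Real.rpow_le_rpow_of_exponent_le (by norm_num) hr).trans ?_
    rw [Real.rpow_neg (by norm_num)]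
    norm_num
  -- The threshold satisfies `2^(0.108n) ≤ e^(0.075n) ≤ 2^(0.11n)`. Above it, point masses beat the
  -- roughly `2^(0.1n)` ones of `f`, and the constant tree suffices; below it, the `2^(-0.2n)` of
  -- the tail bound wins.
  rcases le_or_gt (0.075 * (n : ℝ)) (∑ i, min (p i : ℝ) (1 - p i)) with hH | hH
  · refine ⟨.leaf false, Nat.zero_le _, ?_⟩
    calc (ParityTree.leaf false).err f (productDist p)
        = ∑ x with f x = true, (productDist p).1 x := by
          rw [Finset.sum_filter]
          refine Finset.sum_congr rfl fun x _ => ?_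
          by_cases hx : f x = true <;> simp [ParityTree.eval, hx]
      _ ≤ ∑ x with f x = true, Real.exp (-(0.075 * n)) :=
          Finset.sum_le_sum fun x _ =>
            (productDist_le_exp p x).trans (Real.exp_le_exp.2 (neg_le_neg hH))
      _ = onesIn f Finset.univ * Real.exp (-(0.075 * n)) := by
          rw [Finset.sum_const, nsmul_eq_mul]
          rfl
      _ ≤ 2 * 2 ^ (0.1 * (n : ℝ)) * 2 ^ (-(0.108 * (n : ℝ))) := by
          refine mul_le_mul (hf.onesIn_univ_bounds (by omega)).2 ?_ (Real.exp_pos _).le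
            (by positivity)
          rw [Real.rpow_def_of_pos (by norm_num)]
          refine Real.exp_le_exp.2 ?_
          nlinarith
      _ = 2 * 2 ^ (-(0.008 * (n : ℝ))) := by
          rw [mul_assoc, ← Real.rpow_add (by norm_num)]
          ring_nf
      _ ≤ 1 / 3 := by linarith [hsmall (-(0.008 * (n : ℝ))) (by linarith)]
  · set Z := (hammingBall (mode p)).filter fun x => f x = true with hZ
    -- Six parities suffice because `19/64 + 1/256 < 1/3`.
    obtain ⟨T, hd, he⟩ := exists_tree_err_indicator_le Z (productDist p) 6
    refine ⟨T, hd, ?_⟩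
    have hZc : (Z.card : ℝ) ≤ 19 := by exact_mod_cast Nat.le_of_lt_succ (hf.ball (mode p))
    have htail : ∑ x ∈ (hammingBall (mode p))ᶜ, (productDist p).1 x ≤ 1 / 256 := by
      refine (sum_productDist_notMem_ball_le p).trans ?_
      calc _ ≤ (2 : ℝ) ^ (0.11 * (n : ℝ)) * 2 ^ (-(0.2 * (n : ℝ))) := by
            refine mul_le_mul_of_nonneg_right ?_ (by positivity)
            rw [Real.rpow_def_of_pos (by norm_num)]
            refine Real.exp_le_exp.2 (hH.le.trans ?_)
            nlinarith
        _ = 2 ^ (-(0.09 * (n : ℝ))) := by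
            rw [← Real.rpow_add (by norm_num)]
            ring_nf
        _ ≤ 1 / 256 := hsmall _ (by linarith)
    have hle : T.err f (productDist p) ≤ T.err (fun x => decide (x ∈ Z)) (productDist p) +
        ∑ x ∈ (hammingBall (mode p))ᶜ, (productDist p).1 x := by
      have hc : ∑ x ∈ (hammingBall (mode p))ᶜ, (productDist p).1 x =
          ∑ x, if x ∈ (hammingBall (mode p))ᶜ then (productDist p).1 x else 0 := by
        rw [Finset.sum_ite_mem, Finset.univ_inter]
      rw [hc, ParityTree.err, ParityTree.err, ← Finset.sum_add_distrib]
      refine Finset.sum_le_sum fun x _ => ?_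
      have hx0 := h0 x
      by_cases hx : x ∈ hammingBall (mode p)
      · have hxZ : decide (x ∈ Z) = f x := by simp [hZ, hx]
        simp [hxZ, hx]
      · have hx' : x ∈ (hammingBall (mode p))ᶜ := Finset.mem_compl.2 hx
        rw [if_pos hx']
        split_ifs <;> linarith
    linarith

theorem IsTypical.prodComplexity_le {n : ℕ} {f : BoolFn n} (hf : IsTypical f) (hn : 1000 ≤ n) :
    prodComplexity f ≤ 6 :=
  ciSup_le fun p => hf.distComplexity_le hn p

theorem eventually_le_measure_typical :
    ∀ᶠ n : ℕ in atTop, 1 - (2 : ℝ) ^ (-(1 / 2 * (n : ℝ))) ≤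
      (randomSparse n).real {f : BoolFn n |
        0.01 * n ≤ disc f ∧ disc f ≤ 1 * n ∧ prodComplexity f ≤ 6} := by
  filter_upwards [eventually_measure_not_isTypical_le, eventually_ge_atTop 1000] with n hn hn'
  have hsub : {f : BoolFn n | ¬ IsTypical f}ᶜ ⊆ {f : BoolFn n |
      0.01 * n ≤ disc f ∧ disc f ≤ 1 * n ∧ prodComplexity f ≤ 6} := by
    intro f hf
    have hf' : IsTypical f := by simpa using hf
    exact ⟨hf'.le_disc (by omega), by simpa using disc_le f, hf'.prodComplexity_le hn'⟩
  refine le_trans ?_ (MeasureTheory.measureReal_mono hsub)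
  rw [MeasureTheory.probReal_compl_eq_one_sub (measurableSet_boolFn _)]
  linarith

theorem exists_disc_isTheta_prodComplexity_isBigO :
    ∃ f : (n : ℕ) → BoolFn n,
      (fun n : ℕ => disc (f n)) =Θ[atTop] (fun n : ℕ => (n : ℝ)) ∧
      (fun n : ℕ => (prodComplexity (f n) : ℝ)) =O[atTop] (fun _ : ℕ => (1 : ℝ)) := by
  -- For the small `n` where no good function need exist, any default will do.
  have hex : ∀ n : ℕ, ∃ f : BoolFn n,
      (∃ g : BoolFn n, 0.01 * n ≤ disc g ∧ prodComplexity g ≤ 6) →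
        0.01 * n ≤ disc f ∧ prodComplexity f ≤ 6 := by
    intro n
    by_cases h : ∃ g : BoolFn n, 0.01 * n ≤ disc g ∧ prodComplexity g ≤ 6
    · obtain ⟨g, hg⟩ := h
      exact ⟨g, fun _ => hg⟩
    · exact ⟨fun _ => false, fun h' => absurd h' h⟩
  choose f hf using hex
  have hev : ∀ᶠ n : ℕ in atTop, 0.01 * n ≤ disc (f n) ∧ prodComplexity (f n) ≤ 6 := by
    filter_upwards [eventually_le_measure_typical, eventually_ge_atTop 1] with n hn hn'
    refine hf n ?_
    have hpos : (2 : ℝ) ^ (-(1 / 2 * (n : ℝ))) < 1 := by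
      refine Real.rpow_lt_one_of_one_lt_of_neg (by norm_num) ?_
      have : (1 : ℝ) ≤ n := by exact_mod_cast hn'
      linarith
    by_contra hne
    have hempty : {f : BoolFn n | 0.01 * n ≤ disc f ∧ disc f ≤ 1 * n ∧ prodComplexity f ≤ 6} = ∅ :=
      Set.eq_empty_iff_forall_notMem.2 fun g hg => hne ⟨g, hg.1, hg.2.2⟩
    rw [hempty, MeasureTheory.measureReal_empty] at hn
    linarith
  refine ⟨f, ⟨IsBigO.of_bound 1 ?_, IsBigO.of_bound 100 ?_⟩, IsBigO.of_bound 6 ?_⟩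
  · refine Eventually.of_forall fun n => ?_
    rw [Real.norm_of_nonneg (disc_nonneg _)]
    simpa using disc_le (f n)
  · filter_upwards [hev] with n hn
    rw [Real.norm_of_nonneg (disc_nonneg _), Real.norm_natCast]
    linarith [hn.1]
  · filter_upwards [hev] with n hn
    simp only [Real.norm_natCast, norm_one, mul_one]
    exact_mod_cast hn.2

end ParityTrees

end

theorem mainTheorem7 :
    -- majority: `disc = O(log n)` but `D^× = Θ(n)`
    ((fun n : ℕ => ParityTrees.disc (ParityTrees.majority n)) =O[atTop]
        (fun n : ℕ => Real.log (n : ℝ)) ∧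
      (fun n : ℕ => (ParityTrees.prodComplexity (ParityTrees.majority n) : ℝ)) =Θ[atTop]
        (fun n : ℕ => (n : ℝ))) ∧
    -- there are functions with `disc = Θ(n)` but `D^× = O(1)`
    (∃ f : (n : ℕ) → ParityTrees.BoolFn n,
      (fun n : ℕ => ParityTrees.disc (f n)) =Θ[atTop] (fun n : ℕ => (n : ℝ)) ∧
      (fun n : ℕ => (ParityTrees.prodComplexity (f n) : ℝ)) =O[atTop]
        (fun _ : ℕ => (1 : ℝ))) ∧
    -- and the random sparse function is one with probability `1 - 2^{-Ω(n)}`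
    (∃ (c C δ : ℝ) (K : ℕ), 0 < c ∧ 0 < δ ∧ ∀ᶠ n : ℕ in atTop,
      1 - (2 : ℝ) ^ (-(δ * (n : ℝ))) ≤
        (ParityTrees.randomSparse n).real
          {f : ParityTrees.BoolFn n |
            c * n ≤ ParityTrees.disc f ∧ ParityTrees.disc f ≤ C * n ∧
              ParityTrees.prodComplexity f ≤ K}) :=
  ⟨⟨ParityTrees.disc_majority_isBigO, ParityTrees.prodComplexity_majority_isTheta⟩,
    ParityTrees.exists_disc_isTheta_prodComplexity_isBigO,
    0.01, 1, 1 / 2, 6, by norm_num, by norm_num, ParityTrees.eventually_le_measure_typical⟩
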